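/- All graphs are finite and simple. For a graph $G=(V,E)$, a function $f\colon E\to\mathbb{Z}$ and a function $g\colon V\to\mathbb{N}=\{0,1,2,\dots\}$, let \[ s_{(f,g)}(v)=g(v)+\sum_{e\in E,\ v\in e} f(e)\qquad (v\in V). \] For positive integers $k_1,k_2$ and constants $c,\delta\in\mathbb{N}$, let $P(k_1,k_2,c,\delta)$ be the following assertion: for every graph $G=(V,E)$ with minimum degree at least $\delta$, every set $L$ of integers with $|L|=|E|$ and $\{1,\dots,c|V|\}\subseteq L$, and every function $g\colon V\to\mathbb{N}$, there is a bijection $f\colon E\to L$ such that $s_{(f,g)}(v)\neq s_{(f,g)}(w)$ for all distinct $v,w\in V$, and $s_{(f,g)}(v)$ is not divisible by $k_1k_2$ for any $v\in V$. Lemma. For all odd coprime integers $k_1,k_2\ge 9$ there are constants $c=c(k_1,k_2)$ and $\delta=\delta(k_1,k_2)$ such that $P(k_1,k_2,c,\delta)$ holds. Moreover, $P(13,11,297,1663)$ holds. -/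

import Mathlib

universe u

/-- The partial sum `s_{(G,f,g)}(v) = g(v) + ∑_{v ∈ e ∈ E(G)} f(e)`. Only the values of `f` on the
edges of `G` are used. -/
def vertexSum {V : Type u} [Fintype V] [DecidableEq V] (G : SimpleGraph V) [DecidableRel G.Adj]
    (f : Sym2 V → ℤ) (g : V → ℕ) (v : V) : ℤ :=
  (g v : ℤ) + ∑ e ∈ G.incidenceFinset v, f e

/-- `f` is `g`-antimagic: the sums `s_{(G,f,g)}(v)` at different vertices are distinct. -/
def IsAntimagicWith {V : Type u} [Fintype V] [DecidableEq V] (G : SimpleGraph V)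
    [DecidableRel G.Adj] (f : Sym2 V → ℤ) (g : V → ℕ) : Prop :=
  ∀ v w : V, v ≠ w → vertexSum G f g v ≠ vertexSum G f g w

/-- The constants `c` and `δ` work for the pair `k₁`, `k₂`: every finite graph `G = (V, E)` of minimum
degree at least `δ`, every set `L` of `|E|` integers containing `{1, …, c|V|}` and every `g : V → ℕ`
admit a bijective `g`-antimagic labelling `E → L` none of whose vertex sums is divisible by
`k₁ k₂`. -/
def ConstantsWork (k₁ k₂ c δ : ℕ) : Prop :=
  ∀ (V : Type u) [Fintype V] [DecidableEq V] (G : SimpleGraph V) [DecidableRel G.Adj],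
    δ ≤ G.minDegree →
    ∀ L : Finset ℤ, L.card = G.edgeFinset.card →
    Finset.Icc (1 : ℤ) ((c : ℤ) * (Fintype.card V : ℤ)) ⊆ L →
    ∀ g : V → ℕ, ∃ f : Sym2 V → ℤ,
      Set.BijOn f G.edgeSet (L : Set ℤ) ∧
      IsAntimagicWith G f g ∧
      ∀ v : V, ¬ ((k₁ : ℤ) * (k₂ : ℤ) ∣ vertexSum G f g v)

/-! Write K = k₁k₂ and work modulo a multiple M of K, with B a multiple of M. Take a maximal
matching with m edges; the unmatched vertices form an independent set. Three kinds of edges get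
labels from `{1, …, c|V|}`: control paths, which fix all vertex sums modulo M, and matching edges
and private edges of unmatched vertices, whose labels are multiples of B and so leave these residues
alone. All other edges receive the remaining labels once and for all.

A control path `v, w, u` carries labels `b` and `b + 2^j`. Swapping them adds 2^j at v, subtracts
2^j at u and changes nothing at w. With q such toggles starting at each vertex and M ≤ 2^q, binary
expansion reaches every residue. Setting the toggles in order of rank is harmless when u has larger
rank than v. The paths are chosen by Hall-type rounding (`exists_pair_system`,
`exists_control_system`) so that each vertex is the far end of at most one path going the wrong way.
Hence every sum can be steered into a pair `{t x, t x - σ x}`, where σ is known before t is chosen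
(`exists_toggles`).

The targets t (`exists_targets`) avoid multiples of K, separate matched from unmatched vertices,
separate the two ends of each matching edge, and use no residue for more than about m/32 matched
vertices. Two kinds of coincidence remain. Sums at unmatched vertices are made distinct by giving
larger private labels to larger partial sums, since no private edge joins two unmatched vertices.
Sums at ends of different matching edges are made distinct by permuting the matching labels; as few
vertices share a residue, the lopsided local lemma for random permutations applies
(`exists_perm_no_conflict`, `exists_perm_shift_ne`). -/

/-! ### Rounding by Hall's theorem, and elementary choices -/

/-- A fractional assignment whose column sums are at most one and whose row sums are at least
the integral demands can be rounded to pairwise disjoint sets of the demanded sizes. -/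
theorem exists_disjoint_of_fractional {ι α : Type*} [Fintype ι] [DecidableEq ι] [DecidableEq α]
    (A : Finset α) (wt : ι → α → ℚ) (d : ι → ℕ) (nonneg : ∀ i a, 0 ≤ wt i a)
    (col : ∀ a ∈ A, ∑ i, wt i a ≤ 1) (row : ∀ i, (d i : ℚ) ≤ ∑ a ∈ A, wt i a) :
    ∃ S : ι → Finset α, (∀ i, S i ⊆ A) ∧ (∀ i, ∀ a ∈ S i, wt i a ≠ 0) ∧
      (∀ i, (S i).card = d i) ∧ ∀ i j, ∀ a, a ∈ S i → a ∈ S j → i = j := by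
  classical
  -- Each index is split into `d i` copies. Hall's condition holds because the weight demanded by a
  -- set of copies lies on its neighbours, each of which carries at most one.
  let t : (Σ i, Fin (d i)) → Finset α := fun p => A.filter fun a => wt p.1 a ≠ 0
  have hall : ∀ T : Finset (Σ i, Fin (d i)), T.card ≤ (T.biUnion t).card := by
    intro T
    let T' := T.image Sigma.fst
    have h1 : T ⊆ T'.sigma fun i => (Finset.univ : Finset (Fin (d i))) := by
      intro p hp
      simp only [Finset.mem_sigma, Finset.mem_univ, and_true]
      exact Finset.mem_image_of_mem _ hp
    have h2 : T.card ≤ ∑ i ∈ T', d i := by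
      refine (Finset.card_le_card h1).trans ?_
      simp [Finset.card_sigma]
    have h3 : ∀ i ∈ T', ∑ a ∈ A, wt i a ≤ ∑ a ∈ T.biUnion t, wt i a := by
      intro i hi
      obtain ⟨p, hp, rfl⟩ := Finset.mem_image.1 hi
      calc ∑ a ∈ A, wt p.1 a = ∑ a ∈ t p, wt p.1 a := by
            rw [Finset.sum_filter_ne_zero]
        _ ≤ _ := Finset.sum_le_sum_of_subset_of_nonneg
            (Finset.subset_biUnion_of_mem t hp) fun a _ _ => nonneg _ _
    have h4 : (T.card : ℚ) ≤ ((T.biUnion t).card : ℚ) := by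
      calc (T.card : ℚ) ≤ ∑ i ∈ T', (d i : ℚ) := by exact_mod_cast h2
        _ ≤ ∑ i ∈ T', ∑ a ∈ T.biUnion t, wt i a :=
            Finset.sum_le_sum fun i hi => (row i).trans (h3 i hi)
        _ = ∑ a ∈ T.biUnion t, ∑ i ∈ T', wt i a := Finset.sum_comm
        _ ≤ ∑ a ∈ T.biUnion t, (1 : ℚ) := by
            refine Finset.sum_le_sum fun a ha => ?_
            obtain ⟨p, _, hp⟩ := Finset.mem_biUnion.1 ha
            exact (Finset.sum_le_sum_of_subset_of_nonneg (Finset.subset_univ _)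
              fun i _ _ => nonneg i a).trans (col a (Finset.mem_filter.1 hp).1)
        _ = _ := by simp
    exact_mod_cast h4
  obtain ⟨F, Finj, hF⟩ := (Finset.all_card_le_biUnion_card_iff_exists_injective t).1 hall
  refine ⟨fun i => Finset.univ.image fun k => F ⟨i, k⟩, ?_, ?_, ?_, ?_⟩
  · intro i a ha
    obtain ⟨k, _, rfl⟩ := Finset.mem_image.1 ha
    exact (Finset.mem_filter.1 (hF ⟨i, k⟩)).1
  · intro i a ha
    obtain ⟨k, _, rfl⟩ := Finset.mem_image.1 ha
    exact (Finset.mem_filter.1 (hF ⟨i, k⟩)).2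
  · intro i
    rw [Finset.card_image_of_injective, Finset.card_univ, Fintype.card_fin]
    intro k l hkl
    simpa using Finj hkl
  · intro i j a hi hj
    obtain ⟨k, _, rfl⟩ := Finset.mem_image.1 hi
    obtain ⟨l, _, hl⟩ := Finset.mem_image.1 hj
    exact (congrArg Sigma.fst (Finj hl)).symm

/-- Labels from a set of the right size can be added to prescribed integers so that the sums are
distinct: add larger labels to larger integers. -/
theorem exists_bijOn_injOn_add {ι : Type*} [DecidableEq ι] (P : ι → ℤ) (I : Finset ι) :
    ∀ X : Finset ℤ, X.card = I.card → ∃ x : ι → ℤ, Set.BijOn x I X ∧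
      Set.InjOn (fun i => P i + x i) I := by
  induction hn : I.card generalizing I with
  | zero =>
    intro X hX
    rw [Finset.card_eq_zero] at hn hX
    subst hn hX
    exact ⟨fun _ => 0, by simp, by simp⟩
  | succ n ih =>
    intro X hX
    have hI : I.Nonempty := Finset.card_pos.1 (by omega)
    have hXn : X.Nonempty := Finset.card_pos.1 (by omega)
    obtain ⟨i₀, hi₀, hmax⟩ := I.exists_max_image P hI
    set M := X.max' hXn with hM
    have hMX : M ∈ X := X.max'_mem hXn
    obtain ⟨x, hx, hinj⟩ := ih (I.erase i₀) (by rw [Finset.card_erase_of_mem hi₀]; omega)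
      (X.erase M) (by rw [Finset.card_erase_of_mem hMX]; omega)
    have hlt : ∀ i ∈ I, i ≠ i₀ → x i < M := by
      intro i hi hne
      have h := hx.mapsTo (Finset.mem_coe.2 (Finset.mem_erase.2 ⟨hne, hi⟩))
      rw [Finset.mem_coe, Finset.mem_erase] at h
      exact lt_of_le_of_ne (X.le_max' _ h.2) h.1
    refine ⟨Function.update x i₀ M, ⟨?_, ?_, ?_⟩, ?_⟩
    · intro i hi
      by_cases h : i = i₀
      · subst h; simpa using hMX
      · rw [Function.update_of_ne h]
        exact Finset.mem_of_mem_erase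
          (Finset.mem_coe.1 (hx.mapsTo (Finset.mem_coe.2 (Finset.mem_erase.2 ⟨h, hi⟩))))
    · intro i hi j hj hij
      by_cases h : i = i₀ <;> by_cases h' : j = i₀
      · rw [h, h']
      · subst h
        rw [Function.update_self, Function.update_of_ne h'] at hij
        exact absurd hij.symm (hlt j hj h').ne
      · subst h'
        rw [Function.update_self, Function.update_of_ne h] at hij
        exact absurd hij (hlt i hi h).ne
      · rw [Function.update_of_ne h, Function.update_of_ne h'] at hij
        exact hx.injOn (Finset.mem_coe.2 (Finset.mem_erase.2 ⟨h, hi⟩))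
          (Finset.mem_coe.2 (Finset.mem_erase.2 ⟨h', hj⟩)) hij
    · intro y hy
      by_cases h : y = M
      · exact ⟨i₀, hi₀, by simp [h]⟩
      · obtain ⟨i, hi, rfl⟩ := hx.surjOn (Finset.mem_coe.2 (Finset.mem_erase.2 ⟨h, hy⟩))
        rw [Finset.mem_coe, Finset.mem_erase] at hi
        exact ⟨i, hi.2, Function.update_of_ne hi.1 _ _⟩
    · intro i hi j hj hij
      by_cases h : i = i₀ <;> by_cases h' : j = i₀
      · rw [h, h']
      · subst h
        simp only [Function.update_self, Function.update_of_ne h'] at hij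
        have := hlt j hj h'; have := hmax j hj; omega
      · subst h'
        simp only [Function.update_self, Function.update_of_ne h] at hij
        have := hlt i hi h; have := hmax i hi; omega
      · simp only [Function.update_of_ne h, Function.update_of_ne h'] at hij
        exact hinj (Finset.mem_coe.2 (Finset.mem_erase.2 ⟨h, hi⟩))
          (Finset.mem_coe.2 (Finset.mem_erase.2 ⟨h', hj⟩)) hij

/-- A set can be covered by disjoint sets of size `s`, with the help of `s - 1` spare elements. -/
theorem exists_cover_of_spare {α : Type*} [DecidableEq α] (s : ℕ) (hs : 0 < s) (B : Finset α)
    (hB : s ≤ B.card + 1) (A : Finset α) (hAB : Disjoint A B) :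
    ∃ 𝒴 : Finset (Finset α), (∀ Y ∈ 𝒴, Y.card = s ∧ Y ⊆ A ∪ B) ∧
      (∀ Y ∈ 𝒴, ∀ Y' ∈ 𝒴, ∀ a, a ∈ Y → a ∈ Y' → Y = Y') ∧ ∀ a ∈ A, ∃ Y ∈ 𝒴, a ∈ Y := by
  induction hn : A.card using Nat.strong_induction_on generalizing A with
  | _ n ih =>
  by_cases h0 : A = ∅
  · exact ⟨∅, by simp, by simp, by simp [h0]⟩
  have hpos : 0 < A.card := Finset.card_pos.2 (Finset.nonempty_iff_ne_empty.2 h0)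
  by_cases hle : s ≤ A.card
  · obtain ⟨Y, hYA, hY⟩ := Finset.exists_subset_card_eq hle
    obtain ⟨𝒴, h1, h2, h3⟩ := ih (A \ Y).card
      (by rw [Finset.card_sdiff_of_subset hYA]; omega) (A \ Y)
      (hAB.mono_left Finset.sdiff_subset) rfl
    have hdis : ∀ Y' ∈ 𝒴, ∀ a, a ∈ Y → a ∉ Y' := by
      intro Y' hY' a ha ha'
      have := (h1 Y' hY').2 ha'
      rw [Finset.mem_union, Finset.mem_sdiff] at this
      rcases this with h | h
      · exact h.2 ha
      · exact Finset.disjoint_left.1 hAB (hYA ha) h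
    refine ⟨insert Y 𝒴, ?_, ?_, ?_⟩
    · intro Y' hY'
      rcases Finset.mem_insert.1 hY' with rfl | hY'
      · exact ⟨hY, hYA.trans Finset.subset_union_left⟩
      · exact ⟨(h1 Y' hY').1, (h1 Y' hY').2.trans
          (Finset.union_subset_union_left Finset.sdiff_subset)⟩
    · intro Y₁ hY₁ Y₂ hY₂ a ha₁ ha₂
      rcases Finset.mem_insert.1 hY₁ with e₁ | k₁ <;>
        rcases Finset.mem_insert.1 hY₂ with e₂ | k₂
      · rw [e₁, e₂]
      · exact absurd ha₂ (hdis _ k₂ a (e₁ ▸ ha₁))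
      · exact absurd ha₁ (hdis _ k₁ a (e₂ ▸ ha₂))
      · exact h2 _ k₁ _ k₂ a ha₁ ha₂
    · intro a ha
      by_cases haY : a ∈ Y
      · exact ⟨Y, Finset.mem_insert_self _ _, haY⟩
      · obtain ⟨Y', hY', h⟩ := h3 a (Finset.mem_sdiff.2 ⟨ha, haY⟩)
        exact ⟨Y', Finset.mem_insert_of_mem hY', h⟩
  -- Fewer than s but at least one element is left, so at most s - 1 spare elements are needed, and
  -- only this once.
  · obtain ⟨B', hB', hcard⟩ := Finset.exists_subset_card_eq (s := B) (n := s - A.card) (by omega)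
    refine ⟨{A ∪ B'}, ?_, ?_, ?_⟩
    · intro Y hY
      rw [Finset.mem_singleton] at hY
      subst hY
      refine ⟨?_, Finset.union_subset_union_right hB'⟩
      rw [Finset.card_union_of_disjoint (hAB.mono_right hB')]
      omega
    · intro Y hY Y' hY' a _ _
      rw [Finset.mem_singleton.1 hY, Finset.mem_singleton.1 hY']
    · intro a ha
      exact ⟨_, Finset.mem_singleton_self _, Finset.mem_union_left _ ha⟩

/-! ### Lopsided local lemma for permutations -/

/-- A permutation moving `x`, `y` to `x'`, `y'` that sends every other moved point to `x` or `y`. -/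
theorem exists_perm_pair {ι : Type*} [DecidableEq ι] {x y x' y' : ι} (h : x ≠ y) (h' : x' ≠ y') :
    ∃ σ : Equiv.Perm ι, σ x = x' ∧ σ y = y' ∧
      ∀ v, v ≠ x → v ≠ y → σ v ≠ x → σ v ≠ y → σ v = v := by
  refine ⟨(Equiv.swap x x').trans (Equiv.swap (Equiv.swap x x' y) y'), ?_, ?_, ?_⟩
  · simp only [Equiv.trans_apply, Equiv.swap_apply_def]
    grind
  · simp
  · intro v
    simp only [Equiv.trans_apply, Equiv.swap_apply_def]
    grind

/-- The permutations containing no pair of cells from `T`. -/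
def permAvoiding {ι : Type*} [Fintype ι] [DecidableEq ι] (T : Finset (Sym2 (ι × ι))) :
    Finset (Equiv.Perm ι) :=
  Finset.univ.filter fun π => ∀ p ∈ T, ¬ ∀ c ∈ p, π c.1 = c.2

/-- The permutations in `permAvoiding T` that contain both cells of `p`. -/
def permAvoidingThrough {ι : Type*} [Fintype ι] [DecidableEq ι] (T : Finset (Sym2 (ι × ι)))
    (p : Sym2 (ι × ι)) : Finset (Equiv.Perm ι) :=
  (permAvoiding T).filter fun π => ∀ c ∈ p, π c.1 = c.2

/-- If no pair in `T` meets the rows and columns of the two cells of `p`, then containing `p` is no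
more likely than containing any other two cells in the same rows. -/
theorem card_permAvoidingThrough_mul_le {ι : Type*} [Fintype ι] [DecidableEq ι]
    (T : Finset (Sym2 (ι × ι))) {i j x y : ι} (hxy : x ≠ y)
    (hT : ∀ p ∈ T, ∀ c ∈ p, c.1 ≠ i ∧ c.1 ≠ j ∧ c.2 ≠ x ∧ c.2 ≠ y) :
    (permAvoidingThrough T s((i, x), (j, y))).card *
      (Fintype.card ι * Fintype.card ι - Fintype.card ι) ≤ (permAvoiding T).card := by
  classical
  have key : ∀ z : ι × ι, ∃ σ : Equiv.Perm ι, z.1 ≠ z.2 → σ x = z.1 ∧ σ y = z.2 ∧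
      ∀ v, v ≠ x → v ≠ y → σ v ≠ x → σ v ≠ y → σ v = v := by
    intro z
    by_cases hz : z.1 = z.2
    · exact ⟨1, fun h => absurd hz h⟩
    · obtain ⟨σ, hσ⟩ := exists_perm_pair hxy hz
      exact ⟨σ, fun _ => hσ⟩
  choose σ hσ using key
  have hoff : (Finset.univ : Finset ι).offDiag.card
      = Fintype.card ι * Fintype.card ι - Fintype.card ι := by
    rw [Finset.offDiag_card, Finset.card_univ]
  rw [← hoff, ← Finset.card_product]
  -- Switching: a permutation through both cells and a pair z of distinct columns give a permutation
  -- sending i, j to z. The map is injective since z is read off at i and j.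
  refine Finset.card_le_card_of_injOn (fun w => w.1.trans (σ w.2)) ?_ ?_
  · rintro ⟨π, z⟩ hw
    simp only [Finset.coe_product, Set.mem_prod, Finset.mem_coe, permAvoidingThrough,
      permAvoiding, Finset.mem_filter, Finset.mem_univ, true_and, Finset.mem_offDiag] at hw
    obtain ⟨⟨hav, hthrough⟩, hz⟩ := hw
    have hi : π i = x := hthrough (i, x) (Sym2.mem_mk_left _ _)
    have hj : π j = y := hthrough (j, y) (Sym2.mem_mk_right _ _)
    obtain ⟨h1, h2, h3⟩ := hσ z hz
    simp only [permAvoiding, Finset.coe_filter, Finset.mem_univ, true_and, Set.mem_ofPred_eq]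
    intro p hp hall
    refine hav p hp fun c hc => ?_
    obtain ⟨ci, cj, cx, cy⟩ := hT p hp c hc
    have hc' : σ z (π c.1) = c.2 := hall c hc
    -- A cell outside the four lines that lies in the switched permutation was already in π, so no
    -- forbidden pair is created.
    rw [← h3 (π c.1) (fun h => ci (π.injective (h.trans hi.symm)))
      (fun h => cj (π.injective (h.trans hj.symm))) (hc' ▸ cx) (hc' ▸ cy)]
    exact hc'
  · rintro ⟨π, z⟩ hw ⟨π', z'⟩ hw' heq
    simp only [Finset.coe_product, Set.mem_prod, Finset.mem_coe, permAvoidingThrough,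
      permAvoiding, Finset.mem_filter, Finset.mem_univ, true_and, Finset.mem_offDiag] at hw hw'
    have hi : π i = x := hw.1.2 (i, x) (Sym2.mem_mk_left _ _)
    have hj : π j = y := hw.1.2 (j, y) (Sym2.mem_mk_right _ _)
    have hi' : π' i = x := hw'.1.2 (i, x) (Sym2.mem_mk_left _ _)
    have hj' : π' j = y := hw'.1.2 (j, y) (Sym2.mem_mk_right _ _)
    obtain ⟨h1, h2, -⟩ := hσ z hw.2
    obtain ⟨h1', h2', -⟩ := hσ z' hw'.2
    have e1 := Equiv.ext_iff.1 heq i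
    have e2 := Equiv.ext_iff.1 heq j
    simp only [Equiv.trans_apply, hi, hi', hj, hj', h1, h1', h2, h2'] at e1 e2
    have hz : z = z' := Prod.ext e1 e2
    subst hz
    have : π = π' := by
      ext k
      exact (σ z).injective (Equiv.ext_iff.1 heq k)
    rw [this]

/-- The lopsided local lemma for permutations: if every cell is in conflict with at most `D` cells
and `16 D < |ι|`, then some permutation contains no two conflicting cells. -/
theorem exists_perm_no_conflict {ι : Type*} [Fintype ι] [DecidableEq ι]
    (R : ι × ι → ι × ι → Prop) (D : ℕ) (symm : ∀ c c', R c c' → R c' c)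
    (irr : ∀ c c', R c c' → c.1 ≠ c'.1)
    (deg : ∀ c, {c' | R c c'}.ncard ≤ D) (hD : 16 * D ≤ Fintype.card ι - 1) :
    ∃ π : Equiv.Perm ι, ∀ i j, ¬ R (i, π i) (j, π j) := by
  classical
  rcases Nat.eq_zero_or_pos D with rfl | hDpos
  · refine ⟨1, fun i j h => ?_⟩
    have := deg (i, i)
    rw [Nat.le_zero, Set.ncard_eq_zero (Set.toFinite _)] at this
    exact (Set.eq_empty_iff_forall_notMem.1 this) (j, j) h
  set m := Fintype.card ι with hm
  have hm17 : 17 ≤ m := by omega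
  set Q := m * m - m with hQ
  have hQ' : (Q : ℕ) + m = m * m := by
    have : m ≤ m * m := Nat.le_mul_self m
    omega
  -- Conflicts within a column are dropped: no permutation contains two such cells.
  let conf : ι × ι → Finset (ι × ι) := fun c => Finset.univ.filter fun c' => R c c' ∧ c.2 ≠ c'.2
  have hconf : ∀ c, (conf c).card ≤ D := by
    intro c
    refine le_trans ?_ (deg c)
    rw [← Set.ncard_coe_finset]
    refine Set.ncard_le_ncard ?_ (Set.toFinite _)
    intro c' hc'
    exact (Finset.mem_filter.1 (Finset.mem_coe.1 hc')).2.1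
  let 𝓔 : Finset (Sym2 (ι × ι)) := Finset.univ.biUnion fun c => (conf c).image fun c' => s(c, c')
  have h𝓔 : ∀ c c', s(c, c') ∈ 𝓔 → R c c' ∧ c.2 ≠ c'.2 := by
    intro c c' h
    simp only [𝓔, conf, Finset.mem_biUnion, Finset.mem_univ, true_and, Finset.mem_image,
      Finset.mem_filter] at h
    obtain ⟨d, d', ⟨h1, h2⟩, h3⟩ := h
    rcases Sym2.eq_iff.1 h3 with ⟨rfl, rfl⟩ | ⟨rfl, rfl⟩
    · exact ⟨h1, h2⟩
    · exact ⟨symm _ _ h1, h2.symm⟩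
  -- Given that T is avoided, each event p has conditional probability at most 2/Q, where Q = m(m -
  -- 1).
  have claim : ∀ n : ℕ, ∀ T ⊆ 𝓔, T.card = n → ∀ p ∈ 𝓔,
      (permAvoidingThrough T p).card * Q ≤ 2 * (permAvoiding T).card := by
    intro n
    induction n using Nat.strong_induction_on with
    | _ n ih =>
    intro T hT hn p hp
    induction p using Sym2.ind with
    | _ c c' =>
    obtain ⟨hR, hcol⟩ := h𝓔 c c' hp
    have hrow := irr _ _ hR
    let lines : Finset (ι × ι) := Finset.univ.filter fun d =>
      d.1 = c.1 ∨ d.1 = c'.1 ∨ d.2 = c.2 ∨ d.2 = c'.2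
    have hlines : lines.card ≤ 4 * m := by
      have hsub : lines ⊆ (({c.1, c'.1} : Finset ι) ×ˢ Finset.univ) ∪
          (Finset.univ ×ˢ ({c.2, c'.2} : Finset ι)) := by
        intro d hd
        simp only [lines, Finset.mem_filter, Finset.mem_univ, true_and] at hd
        simp only [Finset.mem_union, Finset.mem_product, Finset.mem_insert, Finset.mem_singleton,
          Finset.mem_univ, and_true, true_and]
        tauto
      refine (Finset.card_le_card hsub).trans ((Finset.card_union_le _ _).trans ?_)
      rw [Finset.card_product, Finset.card_product, Finset.card_univ]
      have h1 := Finset.card_le_two (a := c.1) (b := c'.1)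
      have h2 := Finset.card_le_two (a := c.2) (b := c'.2)
      nlinarith
    -- Only pairs meeting the four lines of p can be created by switching; they form T₂, and T₁ is
    -- the harmless rest.
    let T₁ := T.filter fun p' => ∀ d ∈ p', d ∉ lines
    let T₂ := T.filter fun p' => ¬ ∀ d ∈ p', d ∉ lines
    have hT₁ : T₁ ⊆ T := Finset.filter_subset _ _
    have hT₂ : T₂.card ≤ 4 * m * D := by
      have hsub : T₂ ⊆ lines.biUnion fun d => (conf d).image fun d' => s(d, d') := by
        intro p' hp'
        rw [Finset.mem_filter] at hp'
        obtain ⟨hp'T, hp'⟩ := hp'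
        push Not at hp'
        obtain ⟨d, hd, hdl⟩ := hp'
        obtain ⟨d', rfl⟩ := hd
        obtain ⟨h1, h2⟩ := h𝓔 _ _ (hT hp'T)
        refine Finset.mem_biUnion.2 ⟨d, hdl, Finset.mem_image.2 ⟨d', ?_, rfl⟩⟩
        exact Finset.mem_filter.2 ⟨Finset.mem_univ _, h1, h2⟩
      refine (Finset.card_le_card hsub).trans (Finset.card_biUnion_le.trans ?_)
      calc _ ≤ ∑ d ∈ lines, D :=
            Finset.sum_le_sum fun d _ => Finset.card_image_le.trans (hconf d)
        _ = lines.card * D := by simp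
        _ ≤ _ := Nat.mul_le_mul_right _ hlines
    have hinj : (permAvoidingThrough T₁ s(c, c')).card * Q ≤ (permAvoiding T₁).card := by
      refine card_permAvoidingThrough_mul_le T₁ hcol fun p' hp' d hd => ?_
      have := (Finset.mem_filter.1 hp').2 d hd
      simp only [lines, Finset.mem_filter, Finset.mem_univ, true_and, not_or] at this
      exact this
    have hmono : (permAvoidingThrough T s(c, c')).card ≤
        (permAvoidingThrough T₁ s(c, c')).card := by
      refine Finset.card_le_card fun π hπ => ?_
      simp only [permAvoidingThrough, permAvoiding, Finset.mem_filter, Finset.mem_univ,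
        true_and] at hπ ⊢
      exact ⟨fun p' hp' => hπ.1 p' (hT₁ hp'), hπ.2⟩
    have hlower : (permAvoiding T₁).card ≤ 2 * (permAvoiding T).card := by
      have hcover : permAvoiding T₁ ⊆ permAvoiding T ∪ T₂.biUnion (permAvoidingThrough T₁) := by
        intro π hπ
        by_cases h : π ∈ permAvoiding T
        · exact Finset.mem_union_left _ h
        · refine Finset.mem_union_right _ (Finset.mem_biUnion.2 ?_)
          simp only [permAvoiding, Finset.mem_filter, Finset.mem_univ, true_and] at h hπ
          push Not at h
          obtain ⟨p', hp', hall⟩ := h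
          refine ⟨p', ?_, ?_⟩
          · by_contra h2
            have : p' ∈ T₁ := by
              by_contra h1
              exact h2 (Finset.mem_filter.2 ⟨hp', fun h => h1 (Finset.mem_filter.2 ⟨hp', h⟩)⟩)
            exact hπ p' this hall
          · simp only [permAvoidingThrough, permAvoiding, Finset.mem_filter, Finset.mem_univ,
              true_and]
            exact ⟨hπ, hall⟩
      have hcard := (Finset.card_le_card hcover).trans (Finset.card_union_le _ _)
      rcases T₂.eq_empty_or_nonempty with h0 | hne
      · rw [h0] at hcard
        simp at hcard
        omega
      · have hlt : T₁.card < n := by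
          rw [← hn]
          refine Finset.card_lt_card (Finset.ssubset_iff_subset_ne.2 ⟨hT₁, fun h => ?_⟩)
          obtain ⟨p', hp'⟩ := hne
          rw [Finset.mem_filter] at hp'
          rw [← h] at hp'
          exact hp'.2 (Finset.mem_filter.1 hp'.1).2
        have hsum : (T₂.biUnion (permAvoidingThrough T₁)).card * Q ≤
            T₂.card * (2 * (permAvoiding T₁).card) := by
          calc _ ≤ (∑ p' ∈ T₂, (permAvoidingThrough T₁ p').card) * Q :=
                Nat.mul_le_mul_right _ Finset.card_biUnion_le
            _ = ∑ p' ∈ T₂, (permAvoidingThrough T₁ p').card * Q := Finset.sum_mul _ _ _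
            _ ≤ ∑ p' ∈ T₂, 2 * (permAvoiding T₁).card :=
                Finset.sum_le_sum fun p' hp' =>
                  ih _ hlt T₁ (hT₁.trans hT) rfl p' (hT (Finset.mem_filter.1 hp').1)
            _ = _ := by simp
        -- The events in T₂ have total conditional probability at most 4mD · 2/Q ≤ 1/2, so avoiding
        -- them as well loses at most a factor 2. This is where 16D ≤ m - 1 enters.
        have h16 : 4 * T₂.card ≤ Q := by
          have h16' : 16 * D + 1 ≤ m := by omega
          nlinarith
        have hQpos : 0 < Q := by nlinarith
        by_contra hcon
        push Not at hcon
        set X := (T₂.biUnion (permAvoidingThrough T₁)).card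
        set W := (permAvoiding T₁).card
        have h1 : W < 2 * X := by omega
        have h2 : 2 * (X * Q) ≤ W * Q := by nlinarith
        nlinarith
    calc _ ≤ (permAvoidingThrough T₁ s(c, c')).card * Q := Nat.mul_le_mul_right _ hmono
      _ ≤ _ := hinj.trans hlower
  have hpos : ∀ T ⊆ 𝓔, 0 < (permAvoiding T).card := by
    intro T
    induction T using Finset.induction_on with
    | empty =>
      intro _
      exact Finset.card_pos.2 ⟨1, by simp [permAvoiding]⟩
    | insert p T hpT ih =>
      intro hT
      have hT' : T ⊆ 𝓔 := (Finset.subset_insert _ _).trans hT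
      have h1 := ih hT'
      have h2 := claim _ T hT' rfl p (hT (Finset.mem_insert_self _ _))
      have hcover : permAvoiding T ⊆ permAvoiding (insert p T) ∪ permAvoidingThrough T p := by
        intro π hπ
        simp only [permAvoidingThrough, permAvoiding, Finset.mem_union, Finset.mem_filter,
          Finset.mem_univ, true_and, Finset.mem_insert] at hπ ⊢
        by_cases h : ∀ c ∈ p, π c.1 = c.2
        · exact Or.inr ⟨hπ, h⟩
        · refine Or.inl fun p' hp' => ?_
          rcases hp' with rfl | hp'
          · exact h
          · exact hπ p' hp'
      have hcard := (Finset.card_le_card hcover).trans (Finset.card_union_le _ _)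
      by_contra hcon
      have hle : (permAvoiding T).card ≤ (permAvoidingThrough T p).card := by omega
      have : 3 ≤ Q := by nlinarith
      nlinarith
  obtain ⟨π, hπ⟩ := Finset.card_pos.1 (hpos 𝓔 (Finset.Subset.refl _))
  refine ⟨π, fun i j h => ?_⟩
  have hne : π i ≠ π j := fun h' => irr _ _ h (π.injective h')
  simp only [permAvoiding, Finset.mem_filter, Finset.mem_univ, true_and] at hπ
  refine hπ s((i, π i), (j, π j)) ?_ ?_
  · simp only [𝓔, conf, Finset.mem_biUnion, Finset.mem_univ, true_and, Finset.mem_image,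
      Finset.mem_filter]
    exact ⟨_, _, ⟨h, hne⟩, rfl⟩
  · intro c hc
    rcases Sym2.mem_iff.1 hc with rfl | rfl <;> rfl

/-! ### Construction of the control paths -/

theorem exists_top_two {V : Type*} [DecidableEq V] (r : V → ℕ) (hr : Function.Injective r)
    (Y : Finset V) (hY : 2 ≤ Y.card) :
    ∃ T ⊆ Y, T.card = 2 ∧ ∀ x ∈ Y \ T, ∀ y ∈ T, r x < r y := by
  obtain ⟨a, ha, hamax⟩ := Y.exists_max_image r (Finset.card_pos.1 (by omega))
  obtain ⟨b, hb, hbmax⟩ := (Y.erase a).exists_max_image r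
    (Finset.card_pos.1 (by rw [Finset.card_erase_of_mem ha]; omega))
  rw [Finset.mem_erase] at hb
  refine ⟨{a, b}, ?_, Finset.card_pair hb.1.symm, ?_⟩
  · intro x hx
    rw [Finset.mem_insert, Finset.mem_singleton] at hx
    rcases hx with rfl | rfl
    · exact ha
    · exact hb.2
  · intro x hx y hy
    simp only [Finset.mem_sdiff, Finset.mem_insert, Finset.mem_singleton, not_or] at hx hy
    rcases hy with rfl | rfl
    · exact lt_of_le_of_ne (hamax x hx.1) fun h => hx.2.1 (hr h)
    · exact lt_of_le_of_ne (hbmax x (Finset.mem_erase.2 ⟨hx.2.1, hx.1⟩)) fun h => hx.2.2 (hr h)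

/-- Disjoint pairs of members of the blocks `Y c` can be chosen so that every `v` is the first
member of `q` of the pairs, and the second members of these have larger rank than `v`, apart from
exceptional pairs, the second members of which are all distinct. -/
theorem exists_pair_system {V γ : Type*} [Fintype V] [DecidableEq V] [DecidableEq γ] (q : ℕ)
    (hq : 0 < q) (C : Finset γ) (Y : γ → Finset V) (hY : ∀ c ∈ C, (Y c).card = 4 * q + 3)
    (hC : ∀ v, 8 * q * q + 6 * q ≤ (C.filter fun c => v ∈ Y c).card) :
    ∃ (ch : V → Fin q → γ) (u : V → Fin q → V) (rank : V → ℕ),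
      (∀ v j, ch v j ∈ C ∧ v ∈ Y (ch v j) ∧ u v j ∈ Y (ch v j) ∧ v ≠ u v j) ∧
      (∀ v j v' j', ch v j = ch v' j' → v = v' → j = j') ∧
      (∀ v j v' j', ch v j = ch v' j' → v ≠ u v' j') ∧
      (∀ v j v' j', ch v j = ch v' j' → u v j = u v' j' → v = v' ∧ j = j') ∧
      (∀ v j v' j', ¬ rank v < rank (u v j) → ¬ rank v' < rank (u v' j') → u v j = u v' j' →
        v = v' ∧ j = j') := by
  classical
  set app : V → ℕ := fun v => (C.filter fun c => v ∈ Y c).card with happ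
  set n := Fintype.card V
  let idx := Fintype.equivFin V
  -- Rank orders vertices by number of appearances, with ties broken by an enumeration. The order by
  -- appearances is what bounds the load in the choice of U.
  let rank : V → ℕ := fun v => app v * n + idx v
  have rank_le : ∀ x y, rank x < rank y → app x ≤ app y := by
    intro x y h
    by_contra hc
    push Not at hc
    have h1 : (idx y : ℕ) < n := (idx y).2
    have h2 : (app y + 1) * n ≤ app x * n := Nat.mul_le_mul_right _ hc
    simp only [rank] at h
    nlinarith
  have rank_inj : Function.Injective rank := by
    intro x y h
    have h1 : (idx y : ℕ) < n := (idx y).2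
    have h2 : (idx x : ℕ) < n := (idx x).2
    have h3 := congrArg (· % n) h
    simp only [rank, Nat.mul_add_mod_self_right, Nat.mod_eq_of_lt h1, Nat.mod_eq_of_lt h2] at h3
    exact idx.injective (Fin.ext h3)
  have htop : ∀ c, ∃ T : Finset V, c ∈ C →
      T ⊆ Y c ∧ T.card = 2 ∧ ∀ x ∈ Y c \ T, ∀ y ∈ T, rank x < rank y := by
    intro c
    by_cases hc : c ∈ C
    · obtain ⟨T, h1, h2⟩ := exists_top_two rank rank_inj (Y c) (by rw [hY c hc]; omega)
      exact ⟨T, fun _ => ⟨h1, h2⟩⟩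
    · exact ⟨∅, fun h => absurd h hc⟩
  choose T hT using htop
  let low : γ → Finset V := fun c => Y c \ T c
  have hlow : ∀ c ∈ C, (low c).card = 4 * q + 1 := by
    intro c hc
    rw [Finset.card_sdiff_of_subset (hT c hc).1, hY c hc, (hT c hc).2.1]
    omega
  -- Each block has 4q + 1 members below its top two. Splitting it equally among them, θ low
  -- appearances are worth q whole blocks.
  let θ := q * (4 * q + 1)
  let lo : V → ℕ := fun v => (C.filter fun c => v ∈ low c).card
  let rich : V → Prop := fun v => θ ≤ lo v
  have hq0 : (0 : ℚ) < q := by exact_mod_cast hq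
  -- chunks in which a rich vertex is the smaller member of its pair
  obtain ⟨F, hFC, hFw, hFcard, hFdisj⟩ := exists_disjoint_of_fractional C
    (fun (v : V) c => if rich v ∧ v ∈ low c then (1 : ℚ) / (4 * q + 1) else 0)
    (fun v => if rich v then q else 0)
    (by intro v c; split_ifs <;> positivity)
    (by
      intro c hc
      calc _ ≤ ∑ v, if v ∈ low c then (1 : ℚ) / (4 * q + 1) else 0 := by
            refine Finset.sum_le_sum fun v _ => ?_
            split_ifs with h1 h2 h2
            · exact le_rfl
            · exact absurd h1.2 h2
            · positivity
            · exact le_rfl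
        _ = 1 := by
            rw [Finset.sum_ite_mem, Finset.univ_inter, Finset.sum_const, hlow c hc, nsmul_eq_mul]
            push_cast
            field_simp
        _ ≤ 1 := le_rfl)
    (by
      intro v
      by_cases hv : rich v
      · simp only [hv, true_and, if_true]
        rw [← Finset.sum_filter, Finset.sum_const, nsmul_eq_mul, mul_one_div,
          le_div_iff₀ (by positivity)]
        have : θ ≤ lo v := hv
        exact_mod_cast this
      · simp [hv])
  have hF : ∀ v, ∀ c ∈ F v, c ∈ C ∧ v ∈ low c := by
    intro v c hc
    refine ⟨hFC v hc, ?_⟩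
    have := hFw v c hc
    by_contra h
    simp [h] at this
  -- A poor vertex is on top more than app v - θ times, and a block is split among 2 top members
  -- with q indices each. The hypothesis app v ≥ 2θ + 4q = 8q² + 6q gives app v ≤ 4q · gam v.
  let gam : V → ℕ := fun v => (app v - θ) / (2 * q)
  have hgam : ∀ v, app v ≤ gam v * (4 * q) := by
    intro v
    have h1 : 8 * q * q + 6 * q ≤ app v := hC v
    have h2 := Nat.lt_div_mul_add (a := app v - θ) (b := 2 * q) (by omega)
    have h3 : θ = 4 * (q * q) + q := by simp only [θ]; ring
    have h4 : 8 * q * q = 8 * (q * q) := by ring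
    have h5 : gam v * (4 * q) = 2 * (gam v * (2 * q)) := by ring
    have h6 : app v - θ < gam v * (2 * q) + 2 * q := h2
    rw [h5]
    omega
  have happpos : ∀ v, 0 < app v := by
    intro v
    have : 8 * q * q + 6 * q ≤ app v := hC v
    omega
  -- groups of chunks in which a poor vertex is the larger member of its pair
  obtain ⟨Grp, hGC, hGw, hGcard, hGdisj⟩ := exists_disjoint_of_fractional C
    (fun (p : V × Fin q) c => if ¬ rich p.1 ∧ p.1 ∈ T c then (1 : ℚ) / (2 * q) else 0)
    (fun p => if rich p.1 then 0 else gam p.1)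
    (by intro p c; split_ifs <;> positivity)
    (by
      intro c hc
      calc _ ≤ ∑ p : V × Fin q, if p.1 ∈ T c then (1 : ℚ) / (2 * q) else 0 := by
            refine Finset.sum_le_sum fun v _ => ?_
            split_ifs with h1 h2 h2
            · exact le_rfl
            · exact absurd h1.2 h2
            · positivity
            · exact le_rfl
        _ = ∑ v : V, ∑ _i : Fin q, if v ∈ T c then (1 : ℚ) / (2 * q) else 0 :=
            Fintype.sum_prod_type _
        _ = 1 := by
            simp only [Finset.sum_const, Finset.card_univ, Fintype.card_fin]
            rw [← Finset.smul_sum, Finset.sum_ite_mem, Finset.univ_inter, Finset.sum_const,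
              (hT c hc).2.1]
            simp only [nsmul_eq_mul]
            push_cast
            field_simp
        _ ≤ 1 := le_rfl)
    (by
      rintro ⟨v, i⟩
      by_cases hv : rich v
      · simp [hv]
      · simp only [hv, not_false_eq_true, true_and, if_false]
        rw [← Finset.sum_filter, Finset.sum_const, nsmul_eq_mul, mul_one_div,
          le_div_iff₀ (by positivity)]
        have h1 : app v = lo v + (C.filter fun c => v ∈ T c).card := by
          rw [happ, ← Finset.card_union_of_disjoint]
          · refine congrArg Finset.card ?_
            ext c
            simp only [Finset.mem_filter, Finset.mem_union, low, Finset.mem_sdiff]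
            constructor
            · rintro ⟨h1, h2⟩
              by_cases h : v ∈ T c
              · exact Or.inr ⟨h1, h⟩
              · exact Or.inl ⟨h1, h2, h⟩
            · rintro (⟨h1, h2, -⟩ | ⟨h1, h2⟩)
              · exact ⟨h1, h2⟩
              · exact ⟨h1, (hT c h1).1 h2⟩
          · refine Finset.disjoint_left.2 fun c h h' => ?_
            simp only [Finset.mem_filter, low, Finset.mem_sdiff] at h h'
            exact h.2.2 h'.2
        have h2 : lo v < θ := not_le.1 hv
        have h3 : gam v * (2 * q) ≤ app v - θ := Nat.div_mul_le_self _ _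
        have h4 : gam v * (2 * q) ≤ (C.filter fun c => v ∈ T c).card := by omega
        exact_mod_cast h4)
  have hG : ∀ p, ∀ c ∈ Grp p, c ∈ C ∧ ¬ rich p.1 ∧ p.1 ∈ T c := by
    intro p c hc
    refine ⟨hGC p hc, ?_⟩
    have := hGw p c hc
    by_contra h
    simp [h] at this
  -- A block may serve two pairs: one started by a rich low member, one by a poor top member. At
  -- most one low member is taken by the former.
  let cand : γ → Finset V := fun c => (low c).filter fun x => c ∉ F x
  have hcand : ∀ c ∈ C, 4 * q ≤ (cand c).card := by
    intro c hc
    have h1 := hlow c hc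
    have h2 := Finset.card_filter_add_card_filter_not (s := low c) (fun x => c ∉ F x)
    have h3 : ((low c).filter fun x => ¬ c ∉ F x).card ≤ 1 := by
      refine Finset.card_le_one.2 fun x hx y hy => ?_
      simp only [Finset.mem_filter, not_not] at hx hy
      exact hFdisj x y c hx.2 hy.2
    have h4 : (cand c).card = ((low c).filter fun x => c ∉ F x).card := rfl
    omega
  -- distinct smaller members for the pairs of the poor vertices
  obtain ⟨U, -, hUw, hUcard, hUdisj⟩ := exists_disjoint_of_fractional (Finset.univ : Finset V)
    (fun (p : V × Fin q) x => ∑ c ∈ Grp p, if x ∈ cand c then (1 : ℚ) / (gam p.1 * (4 * q)) else 0)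
    (fun p => if rich p.1 then 0 else 1)
    (by
      intro p x
      refine Finset.sum_nonneg fun c _ => ?_
      split_ifs <;> positivity)
    (by
      intro x _
      -- A vertex x lies in app x blocks, each in at most one group. The group's owner has larger
      -- rank, so each block contributes at most 1/(app x).
      have hax : (0 : ℚ) < app x := by exact_mod_cast happpos x
      calc _ ≤ ∑ p : V × Fin q, ∑ c ∈ Grp p, if x ∈ Y c then (1 : ℚ) / app x else 0 := by
            refine Finset.sum_le_sum fun p _ => Finset.sum_le_sum fun c hc => ?_
            obtain ⟨h1, h2, h3⟩ := hG p c hc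
            split_ifs with h4 h5 h5
            · have h6 : rank x < rank p.1 := (hT c h1).2.2 x (Finset.mem_filter.1 h4).1 p.1 h3
              have h7 := (rank_le _ _ h6).trans (hgam p.1)
              refine one_div_le_one_div_of_le hax ?_
              exact_mod_cast h7
            · exact absurd (Finset.mem_sdiff.1 (Finset.mem_filter.1 h4).1).1 h5
            · positivity
            · exact le_rfl
        _ = (∑ p : V × Fin q, ((Grp p).filter fun c => x ∈ Y c).card : ℕ) * ((1 : ℚ) / app x) := by
            push_cast
            rw [Finset.sum_mul]
            refine Finset.sum_congr rfl fun p _ => ?_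
            rw [← Finset.sum_filter, Finset.sum_const, nsmul_eq_mul]
        _ ≤ app x * ((1 : ℚ) / app x) := by
            refine mul_le_mul_of_nonneg_right ?_ (by positivity)
            rw [← Finset.card_biUnion]
            · norm_cast
              refine Finset.card_le_card fun c hc => ?_
              obtain ⟨p, -, hp⟩ := Finset.mem_biUnion.1 hc
              rw [Finset.mem_filter] at hp
              exact Finset.mem_filter.2 ⟨(hG p c hp.1).1, hp.2⟩
            · intro p _ p' _ hne
              refine Finset.disjoint_left.2 fun c h h' => hne ?_
              exact hGdisj p p' c (Finset.mem_filter.1 h).1 (Finset.mem_filter.1 h').1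
        _ = 1 := by field_simp)
    (by
      rintro ⟨v, i⟩
      by_cases hv : rich v
      · simp only [hv, if_true, Nat.cast_zero]
        refine Finset.sum_nonneg fun x _ => Finset.sum_nonneg fun c _ => ?_
        split_ifs <;> positivity
      · have hg : 0 < gam v * (4 * q) := (happpos v).trans_le (hgam v)
        have hg' : (0 : ℚ) < gam v * (4 * q) := by exact_mod_cast hg
        simp only [hv, if_false, Nat.cast_one]
        rw [Finset.sum_comm]
        calc (1 : ℚ) = ∑ c ∈ Grp (v, i), (4 * q : ℚ) * (1 / (gam v * (4 * q))) := by
              rw [Finset.sum_const, hGcard, nsmul_eq_mul]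
              simp only [hv, if_false]
              have hg1 : (gam v : ℚ) ≠ 0 := fun h => by simp [h] at hg'
              field_simp
          _ ≤ _ := by
              refine Finset.sum_le_sum fun c hc => ?_
              rw [Finset.sum_ite_mem, Finset.univ_inter, Finset.sum_const, nsmul_eq_mul]
              refine mul_le_mul_of_nonneg_right ?_ (by positivity)
              exact_mod_cast hcand c (hG _ c hc).1)
  -- The second top member is free if the first owns the block as a poor vertex.
  have hrecv : ∀ c ∈ C, ∃ y ∈ T c, ∀ p, c ∈ Grp p → y ≠ p.1 := by
    intro c hc
    obtain ⟨a, b, hab, hTab⟩ := Finset.card_eq_two.1 (hT c hc).2.1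
    by_cases h : ∃ p, c ∈ Grp p ∧ a = p.1
    · obtain ⟨p, hp, rfl⟩ := h
      refine ⟨b, by simp [hTab], fun p' hp' hb => hab ?_⟩
      rw [hGdisj p p' c hp hp', hb]
    · push Not at h
      exact ⟨a, by simp [hTab], h⟩
  have hsys : ∀ v, ∃ (ch : Fin q → γ) (u : Fin q → V),
      (rich v ∧ Function.Injective ch ∧
        ∀ j, ch j ∈ F v ∧ u j ∈ T (ch j) ∧ ∀ p, ch j ∈ Grp p → u j ≠ p.1) ∨
      (¬ rich v ∧ ∀ j, ch j ∈ Grp (v, j) ∧ u j ∈ cand (ch j) ∧ u j ∈ U (v, j)) := by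
    intro v
    by_cases hv : rich v
    · have hc : (F v).card = q := by rw [hFcard, if_pos hv]
      let en := (F v).equivFinOfCardEq hc
      choose recv h1 h2 using hrecv
      refine ⟨fun j => (en.symm j : γ), fun j => recv _ (hF v _ (en.symm j).2).1,
        Or.inl ⟨hv, fun i j h => en.symm.injective (Subtype.ext h),
          fun j => ⟨(en.symm j).2, h1 _ _, h2 _ _⟩⟩⟩
    · have h1 : ∀ j, ∃ u, u ∈ U (v, j) ∧ ∃ c ∈ Grp (v, j), u ∈ cand c := by
        intro j
        obtain ⟨u, hu⟩ := Finset.card_pos.1 (show 0 < (U (v, j)).card by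
          rw [hUcard]; simp [hv])
        obtain ⟨c, hc, h⟩ := Finset.exists_ne_zero_of_sum_ne_zero (hUw _ u hu)
        refine ⟨u, hu, c, hc, ?_⟩
        by_contra h'
        exact h (if_neg h')
      choose u hu c hc hcu using h1
      exact ⟨c, u, Or.inr ⟨hv, fun j => ⟨hc j, hcu j, hu j⟩⟩⟩
  choose ch u hsys using hsys
  have hforw : ∀ v j, rich v → rank v < rank (u v j) := by
    intro v j hv
    rcases hsys v with ⟨-, -, h⟩ | ⟨h, -⟩
    · obtain ⟨h1, h2, -⟩ := h j
      obtain ⟨h3, h4⟩ := hF v _ h1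
      exact (hT _ h3).2.2 v h4 _ h2
    · exact absurd hv h
  have hback : ∀ v j, ¬ rich v → rank (u v j) < rank v := by
    intro v j hv
    rcases hsys v with ⟨h, -⟩ | ⟨-, h⟩
    · exact absurd h hv
    · obtain ⟨h1, h2, -⟩ := h j
      obtain ⟨h3, -, h4⟩ := hG _ _ h1
      exact (hT _ h3).2.2 _ (Finset.mem_filter.1 h2).1 _ h4
  have not_low : ∀ c, ∀ x ∈ T c, x ∉ low c := fun c x h h' => (Finset.mem_sdiff.1 h').2 h
  refine ⟨ch, u, rank, ?_, ?_, ?_, ?_, ?_⟩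
  · intro v j
    rcases hsys v with ⟨hv, -, h⟩ | ⟨hv, h⟩
    · obtain ⟨h1, h2, -⟩ := h j
      obtain ⟨h3, h4⟩ := hF v _ h1
      exact ⟨h3, (Finset.mem_sdiff.1 h4).1, (hT _ h3).1 h2,
        fun e => not_low _ _ h2 (e ▸ h4)⟩
    · obtain ⟨h1, h2, -⟩ := h j
      obtain ⟨h3, -, h4⟩ := hG _ _ h1
      have h5 := (Finset.mem_filter.1 h2).1
      exact ⟨h3, (hT _ h3).1 h4, (Finset.mem_sdiff.1 h5).1,
        fun e => (hback v j hv).ne (congrArg rank e.symm)⟩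
  · rintro v j v' j' hc rfl
    rcases hsys v with ⟨-, hinj, -⟩ | ⟨-, h⟩
    · exact hinj hc
    · exact (Prod.ext_iff.1 (hGdisj _ _ _ (h j).1 (hc ▸ (h j').1))).2
  · intro v j v' j' hc
    rcases hsys v with ⟨hv, -, h⟩ | ⟨hv, h⟩ <;> rcases hsys v' with ⟨hv', -, h'⟩ | ⟨hv', h'⟩
    · intro e
      exact not_low _ _ (h' j').2.1 (hc ▸ e ▸ (hF v _ (h j).1).2)
    · intro e
      exact (Finset.mem_filter.1 (h' j').2.1).2 (hc ▸ e ▸ (h j).1)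
    · intro e
      exact (h' j').2.2 (v, j) (hc ▸ (h j).1) e.symm
    · intro e
      exact not_low _ _ (hc ▸ (hG _ _ (h j).1).2.2) (e ▸ (Finset.mem_filter.1 (h' j').2.1).1)
  · intro v j v' j' hc hu
    rcases hsys v with ⟨hv, hinj, h⟩ | ⟨hv, h⟩ <;> rcases hsys v' with ⟨hv', -, h'⟩ | ⟨hv', h'⟩
    · have e : v = v' := hFdisj v v' _ (h j).1 (hc ▸ (h' j').1)
      subst e
      exact ⟨rfl, hinj hc⟩
    · exact absurd (Finset.mem_filter.1 (h' j').2.1).1 (not_low _ _ (hu ▸ hc ▸ (h j).2.1))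
    · exact absurd (Finset.mem_filter.1 (h j).2.1).1 (not_low _ _ (hu ▸ hc ▸ (h' j').2.1))
    · exact Prod.ext_iff.1 (hGdisj _ _ _ (h j).1 (hc ▸ (h' j').1))
  · intro v j v' j' h1 h2 hu
    have hv : ¬ rich v := fun h => h1 (hforw v j h)
    have hv' : ¬ rich v' := fun h => h2 (hforw v' j' h)
    rcases hsys v with ⟨h, -⟩ | ⟨-, h⟩
    · exact absurd h hv
    rcases hsys v' with ⟨h', -⟩ | ⟨-, h'⟩
    · exact absurd h' hv'
    exact Prod.ext_iff.1 (hUdisj _ _ _ (h j).2.2 (hu ▸ (h' j').2.2))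

/-- In a dense enough edge set `A` one can choose a private edge `e v` at every vertex `v`, and
pairwise disjoint two-edge paths `v, w v j, u v j`, disjoint from the private edges, such that the
paths that do not increase the rank have different endpoints `u v j`. -/
theorem exists_control_system {V : Type*} [Fintype V] [DecidableEq V] (q : ℕ) (hq : 0 < q)
    (A : Finset (Sym2 V)) (hA : ∀ e ∈ A, ¬ e.IsDiag)
    (hdeg : ∀ v, 2 * (8 * q * q + 6 * q + (4 * q + 3)) ≤ (A.filter fun e => v ∈ e).card) :
    ∃ (e : V → Sym2 V) (w u : V → Fin q → V) (rank : V → ℕ),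
      (∀ v, e v ∈ A ∧ v ∈ e v) ∧ Function.Injective e ∧
      (∀ v j, s(v, w v j) ∈ A ∧ s(u v j, w v j) ∈ A ∧ v ≠ u v j) ∧
      (∀ x v j, e x ≠ s(v, w v j) ∧ e x ≠ s(u v j, w v j)) ∧
      (∀ v j v' j', s(v, w v j) = s(v', w v' j') → v = v' ∧ j = j') ∧
      (∀ v j v' j', s(u v j, w v j) = s(u v' j', w v' j') → v = v' ∧ j = j') ∧
      (∀ v j v' j', s(v, w v j) ≠ s(u v' j', w v' j')) ∧
      (∀ v j v' j', ¬ rank v < rank (u v j) → ¬ rank v' < rank (u v' j') → u v j = u v' j' →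
        v = v' ∧ j = j') := by
  classical
  set N := 8 * q * q + 6 * q with hN
  -- Each edge is given to at most one of its ends. The edges of v then serve as private edge `e v`,
  -- as edges `S v` leading to middle vertices, and as spare edges `Mo v` for v itself as a middle.
  obtain ⟨O, hOA, hOw, hOcard, hOdisj⟩ := exists_disjoint_of_fractional A
    (fun (v : V) e => if v ∈ e then (1 / 2 : ℚ) else 0) (fun _ => N + (4 * q + 3))
    (by intro v e; split_ifs <;> norm_num)
    (by
      intro e he
      have hd := hA e he
      induction e with
      | _ x y =>
      rw [Sym2.mk_isDiag_iff] at hd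
      simp only [Sym2.mem_iff]
      rw [← Finset.sum_filter, Finset.sum_const, nsmul_eq_mul]
      have : (Finset.univ.filter fun a => a = x ∨ a = y) = {x, y} := by
        ext a; simp
      rw [this, Finset.card_pair hd]
      norm_num)
    (by
      intro v
      rw [← Finset.sum_filter, Finset.sum_const, nsmul_eq_mul]
      have : ((2 * (N + (4 * q + 3)) : ℕ) : ℚ) ≤ (A.filter fun e => v ∈ e).card := by
        exact_mod_cast hdeg v
      push_cast at this ⊢
      linarith)
  have hO : ∀ v, ∀ e ∈ O v, v ∈ e := by
    intro v e he
    have := hOw v e he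
    by_contra h
    simp [h] at this
  have hsplit : ∀ v, ∃ (e : Sym2 V) (S Mo : Finset (Sym2 V)), e ∈ O v ∧ S ⊆ O v ∧ Mo ⊆ O v ∧
      e ∉ S ∧ e ∉ Mo ∧ Disjoint S Mo ∧ S.card = N ∧ Mo.card = 4 * q + 2 := by
    intro v
    obtain ⟨e, he⟩ := Finset.card_pos.1 (show 0 < (O v).card by rw [hOcard]; omega)
    have h1 : ((O v).erase e).card = N + (4 * q + 2) := by
      rw [Finset.card_erase_of_mem he, hOcard]; omega
    obtain ⟨S, hS, hSc⟩ := Finset.exists_subset_card_eq (show N ≤ ((O v).erase e).card by omega)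
    refine ⟨e, S, (O v).erase e \ S, he, hS.trans (Finset.erase_subset _ _),
      Finset.sdiff_subset.trans (Finset.erase_subset _ _), fun h => Finset.notMem_erase _ _ (hS h),
      fun h => Finset.notMem_erase _ _ (Finset.mem_sdiff.1 h).1, Finset.disjoint_sdiff, hSc, ?_⟩
    rw [Finset.card_sdiff_of_subset hS, h1, hSc]
    omega
  choose e S Mo heO hSO hMO heS heM hSM hSc hMc using hsplit
  let In : V → Finset V := fun w => Finset.univ.filter fun v => s(v, w) ∈ S v
  let ends : V → Finset V := fun w => Finset.univ.filter fun y => s(y, w) ∈ Mo w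
  have hcov : ∀ w, ∃ 𝒴 : Finset (Finset V), (∀ Y ∈ 𝒴, Y.card = 4 * q + 3 ∧ Y ⊆ In w ∪ ends w) ∧
      (∀ Y ∈ 𝒴, ∀ Y' ∈ 𝒴, ∀ a, a ∈ Y → a ∈ Y' → Y = Y') ∧ ∀ a ∈ In w, ∃ Y ∈ 𝒴, a ∈ Y := by
    intro w
    refine exists_cover_of_spare _ (by omega) (ends w) ?_ (In w) ?_
    · have : Mo w ⊆ (ends w).image fun y => s(y, w) := by
        intro a ha
        obtain ⟨y, rfl⟩ := Sym2.mem_iff_exists.1 (hO w a (hMO w ha))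
        rw [Sym2.eq_swap] at ha ⊢
        exact Finset.mem_image_of_mem _ (by simpa [ends] using ha)
      have := (Finset.card_le_card this).trans Finset.card_image_le
      rw [hMc] at this
      omega
    · refine Finset.disjoint_left.2 fun v h h' => ?_
      simp only [In, ends, Finset.mem_filter, Finset.mem_univ, true_and] at h h'
      have := hOdisj _ _ _ (hSO _ h) (hMO _ h')
      subst this
      exact Finset.disjoint_left.1 (hSM v) h h'
  choose 𝒴 h𝒴 h𝒴d h𝒴c using hcov
  -- A chunk is a middle vertex with a block of its neighbours; two members of the block give a path
  -- through the middle. Distinct edges of `S v` have distinct middles, so v lies in at least N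
  -- chunks.
  let C : Finset (V × Finset V) := Finset.univ.biUnion fun w => (𝒴 w).image (Prod.mk w)
  have hC : ∀ c, c ∈ C ↔ c.2 ∈ 𝒴 c.1 := by
    rintro ⟨w, Y⟩
    simp [C]
  have hmem : ∀ c ∈ C, ∀ y ∈ c.2, s(y, c.1) ∈ S y ∨ s(y, c.1) ∈ Mo c.1 := by
    intro c hc y hy
    have := ((h𝒴 _ _ ((hC c).1 hc)).2 hy)
    simpa [In, ends] using this
  have hown : ∀ c ∈ C, ∀ y ∈ c.2, s(y, c.1) ∈ A := by
    intro c hc y hy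
    rcases hmem c hc y hy with h | h
    · exact hOA _ (hSO _ h)
    · exact hOA _ (hMO _ h)
  have hinj : ∀ c ∈ C, ∀ y ∈ c.2, ∀ c' ∈ C, ∀ y' ∈ c'.2, s(y, c.1) = s(y', c'.1) →
      c = c' ∧ y = y' := by
    rintro ⟨w, Y⟩ hc y hy ⟨w', Y'⟩ hc' y' hy' h
    have hd := hA _ (hown _ hc y hy)
    have m1 := hmem _ hc y hy
    have m2 := hmem _ hc' y' hy'
    rw [Sym2.mk_isDiag_iff] at hd
    simp only at hy hy' h hd m1 m2
    rw [Sym2.eq_iff] at h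
    rcases h with ⟨rfl, rfl⟩ | ⟨rfl, rfl⟩
    · rw [hC] at hc hc'
      exact ⟨congrArg (Prod.mk w) (h𝒴d _ _ hc _ hc' y hy hy'), rfl⟩
    · exfalso
      rw [Sym2.eq_swap] at m2
      rcases m1 with h | h <;> rcases m2 with h' | h'
      · exact hd (hOdisj _ _ _ (hSO _ h) (hSO _ h'))
      · exact Finset.disjoint_left.1 (hSM y) h h'
      · exact Finset.disjoint_left.1 (hSM _) h' h
      · exact hd (hOdisj _ _ _ (hMO _ h') (hMO _ h))
  have hpriv : ∀ x, ∀ c ∈ C, ∀ y ∈ c.2, e x ≠ s(y, c.1) := by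
    intro x c hc y hy h
    rcases hmem c hc y hy with h' | h' <;> rw [← h] at h'
    · have := hOdisj _ _ _ (heO x) (hSO _ h')
      subst this
      exact heS _ h'
    · have := hOdisj _ _ _ (heO x) (hMO _ h')
      rw [← this] at h'
      exact heM _ h'
  obtain ⟨ch, u, rank, p1, p2, p3, p4, p5⟩ := exists_pair_system q hq C Prod.snd
    (fun c hc => (h𝒴 _ _ ((hC c).1 hc)).1) (by
      intro v
      have : S v ⊆ (C.filter fun c => v ∈ c.2).image fun c => s(v, c.1) := by
        intro a ha
        obtain ⟨w, rfl⟩ := Sym2.mem_iff_exists.1 (hO v a (hSO v ha))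
        obtain ⟨Y, hY, hv⟩ := h𝒴c w v (by simpa [In] using ha)
        exact Finset.mem_image.2 ⟨(w, Y), Finset.mem_filter.2 ⟨(hC _).2 hY, hv⟩, rfl⟩
      have := (Finset.card_le_card this).trans Finset.card_image_le
      rwa [hSc] at this)
  refine ⟨e, fun v j => (ch v j).1, u, rank, fun v => ⟨hOA _ (heO v), hO _ _ (heO v)⟩,
    fun x y h => hOdisj _ _ _ (heO x) (h ▸ heO y), ?_, ?_, ?_, ?_, ?_, p5⟩
  · intro v j
    obtain ⟨h1, h2, h3, h4⟩ := p1 v j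
    exact ⟨hown _ h1 _ h2, hown _ h1 _ h3, h4⟩
  · intro x v j
    obtain ⟨h1, h2, h3, h4⟩ := p1 v j
    exact ⟨hpriv _ _ h1 _ h2, hpriv _ _ h1 _ h3⟩
  · intro v j v' j' h
    obtain ⟨h1, h2, -⟩ := p1 v j
    obtain ⟨h1', h2', -⟩ := p1 v' j'
    obtain ⟨h3, h4⟩ := hinj _ h1 _ h2 _ h1' _ h2' h
    exact ⟨h4, p2 _ _ _ _ h3 h4⟩
  · intro v j v' j' h
    obtain ⟨h1, -, h2, -⟩ := p1 v j
    obtain ⟨h1', -, h2', -⟩ := p1 v' j'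
    obtain ⟨h3, h4⟩ := hinj _ h1 _ h2 _ h1' _ h2' h
    exact p4 _ _ _ _ h3 h4
  · intro v j v' j' h
    obtain ⟨h1, h2, -⟩ := p1 v j
    obtain ⟨h1', -, h2', -⟩ := p1 v' j'
    obtain ⟨h3, h4⟩ := hinj _ h1 _ h2 _ h1' _ h2' h
    exact p3 _ _ _ _ h3 h4

/-! ### Reaching residues with the toggles -/

theorem exists_sum_two_pow_eq {M q : ℕ} [NeZero M] (h : M ≤ 2 ^ q) (r : ZMod M) :
    ∃ ε : Fin q → Bool, (∑ j, if ε j then (2 : ZMod M) ^ (j : ℕ) else 0) = r := by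
  have key : ∀ q n : ℕ, n < 2 ^ q →
      ∃ ε : Fin q → Bool, (∑ j, if ε j then 2 ^ (j : ℕ) else 0) = n := by
    intro q
    induction q with
    | zero => intro n hn; exact ⟨fun _ => false, by simp at hn ⊢; omega⟩
    | succ q ih =>
      intro n hn
      obtain ⟨ε, hε⟩ := ih (n / 2) (by rw [pow_succ] at hn; omega)
      refine ⟨Fin.cons (decide (n % 2 = 1)) ε, ?_⟩
      have h2 : (∑ j : Fin q, if ε j then 2 ^ ((j : ℕ) + 1) else 0) = 2 * (n / 2) := by
        rw [← hε, Finset.mul_sum]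
        refine Finset.sum_congr rfl fun j _ => ?_
        split_ifs
        · rw [pow_succ, mul_comm]
        · rfl
      rw [Fin.sum_univ_succ]
      simp only [Fin.cons_zero, Fin.cons_succ, Fin.val_succ, Fin.val_zero, h2, decide_eq_true_eq,
        pow_zero]
      split_ifs <;> omega
  obtain ⟨ε, hε⟩ := key q r.val ((ZMod.val_lt r).trans_le h)
  refine ⟨ε, ?_⟩
  have := congrArg (Nat.cast : ℕ → ZMod M) hε
  rw [ZMod.natCast_zmod_val] at this
  rw [← this]
  push_cast
  rfl

/-- Toggles that increase the rank can be set successively so that any prescribed residues are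
attained. -/
theorem exists_exact_toggles {V : Type*} [Fintype V] [DecidableEq V] {M q : ℕ} [NeZero M]
    (h : M ≤ 2 ^ q) (u : V → Fin q → V) (rank : V → ℕ) (b t : V → ZMod M) :
    ∃ ε : V → Fin q → Bool, ∀ x, b x + (∑ j, if ε x j then (2 : ZMod M) ^ (j : ℕ) else 0) -
      (∑ p : V × Fin q, if rank p.1 < rank (u p.1 p.2) ∧ u p.1 p.2 = x ∧ ε p.1 p.2 then
        (2 : ZMod M) ^ (p.2 : ℕ) else 0) = t x := by
  have key : ∀ k : ℕ, ∃ ε : V → Fin q → Bool, ∀ x, rank x < k →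
      b x + (∑ j, if ε x j then (2 : ZMod M) ^ (j : ℕ) else 0) -
      (∑ p : V × Fin q, if rank p.1 < rank (u p.1 p.2) ∧ u p.1 p.2 = x ∧ ε p.1 p.2 then
        (2 : ZMod M) ^ (p.2 : ℕ) else 0) = t x := by
    intro k
    induction k with
    | zero => exact ⟨fun _ _ => false, fun x hx => absurd hx (Nat.not_lt_zero _)⟩
    | succ k ih =>
      obtain ⟨ε, hε⟩ := ih
      choose sol hsol using fun x => exists_sum_two_pow_eq h (t x - b x +
        ∑ p : V × Fin q, if rank p.1 < rank (u p.1 p.2) ∧ u p.1 p.2 = x ∧ ε p.1 p.2 then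
          (2 : ZMod M) ^ (p.2 : ℕ) else 0)
      -- Vertices of rank k receive rank-increasing toggles only from ranks already settled, so
      -- their own toggles can compensate for these.
      refine ⟨fun x => if rank x = k then sol x else ε x, fun x hx => ?_⟩
      have hback : (∑ p : V × Fin q, if rank p.1 < rank (u p.1 p.2) ∧ u p.1 p.2 = x ∧
          (if rank p.1 = k then sol p.1 else ε p.1) p.2 then (2 : ZMod M) ^ (p.2 : ℕ) else 0) =
          ∑ p : V × Fin q, if rank p.1 < rank (u p.1 p.2) ∧ u p.1 p.2 = x ∧ ε p.1 p.2 then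
            (2 : ZMod M) ^ (p.2 : ℕ) else 0 := by
        refine Finset.sum_congr rfl fun p _ => ?_
        refine if_congr (and_congr_right fun h1 => and_congr_right fun h2 => ?_) rfl rfl
        rw [h2] at h1
        rw [if_neg (by omega)]
      rw [hback]
      by_cases hk : rank x = k
      · simp only [hk, if_true, hsol]
        ring
      · simp only [hk, if_false]
        exact hε x (by omega)
  obtain ⟨ε, hε⟩ := key (Finset.univ.sup rank + 1)
  exact ⟨ε, fun x => hε x (Nat.lt_succ_of_le (Finset.le_sup (Finset.mem_univ x)))⟩

/-- Residues prescribed at all vertices are attained up to the contribution `σ x` of the single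
toggle that does not increase the rank. -/
theorem exists_toggles {V : Type*} [Fintype V] [DecidableEq V] {M q : ℕ} [NeZero M]
    (h : M ≤ 2 ^ q) (u : V → Fin q → V) (rank : V → ℕ)
    (hu : ∀ v j v' j', ¬ rank v < rank (u v j) → ¬ rank v' < rank (u v' j') → u v j = u v' j' →
      v = v' ∧ j = j') :
    ∃ σ : V → ZMod M, (∀ x, σ x = 0 ∨ ∃ j : Fin q, σ x = 2 ^ (j : ℕ)) ∧
      ∀ b t : V → ZMod M, ∃ ε : V → Fin q → Bool, ∀ x,
        b x + (∑ j, if ε x j then (2 : ZMod M) ^ (j : ℕ) else 0) -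
          (∑ p : V × Fin q, if u p.1 p.2 = x ∧ ε p.1 p.2 then (2 : ZMod M) ^ (p.2 : ℕ) else 0) ∈
            ({t x, t x - σ x} : Set (ZMod M)) := by
  classical
  -- A toggle that does not increase the rank is ignored while solving. At most one ends at x, so it
  -- either leaves t x or subtracts its fixed value σ x.
  let slack : V → V × Fin q → Prop := fun x p => ¬ rank p.1 < rank (u p.1 p.2) ∧ u p.1 p.2 = x
  have hs : ∀ x, (∀ p, ¬ slack x p) ∨ ∃ p, slack x p ∧ ∀ p', slack x p' → p' = p := by
    intro x
    by_cases hx : ∃ p, slack x p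
    · obtain ⟨p, hp⟩ := hx
      refine Or.inr ⟨p, hp, fun p' hp' => ?_⟩
      obtain ⟨h1, h2⟩ := hu _ _ _ _ hp'.1 hp.1 (hp'.2.trans hp.2.symm)
      exact Prod.ext h1 h2
    · exact Or.inl (not_exists.1 hx)
  refine ⟨fun x => ∑ p : V × Fin q, if slack x p then (2 : ZMod M) ^ (p.2 : ℕ) else 0, ?_, ?_⟩
  · intro x
    rcases hs x with h0 | ⟨p, hp, hp'⟩
    · left
      exact Finset.sum_eq_zero fun p _ => if_neg (h0 p)
    · right
      refine ⟨p.2, ?_⟩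
      beta_reduce
      rw [Finset.sum_eq_single p (fun p' _ hne => if_neg fun h' => hne (hp' p' h'))
        (fun h' => absurd (Finset.mem_univ p) h'), if_pos hp]
  · intro b t
    obtain ⟨ε, hε⟩ := exists_exact_toggles h u rank b t
    refine ⟨ε, fun x => ?_⟩
    have hsplit : (∑ p : V × Fin q, if u p.1 p.2 = x ∧ ε p.1 p.2 then
        (2 : ZMod M) ^ (p.2 : ℕ) else 0) =
        (∑ p : V × Fin q, if rank p.1 < rank (u p.1 p.2) ∧ u p.1 p.2 = x ∧ ε p.1 p.2 then
          (2 : ZMod M) ^ (p.2 : ℕ) else 0) +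
        ∑ p : V × Fin q, if slack x p ∧ ε p.1 p.2 then (2 : ZMod M) ^ (p.2 : ℕ) else 0 := by
      rw [← Finset.sum_add_distrib]
      refine Finset.sum_congr rfl fun p _ => ?_
      by_cases h1 : rank p.1 < rank (u p.1 p.2)
      · simp [slack, h1]
      · simp [slack, h1, not_lt.1 h1]
    rw [hsplit, ← sub_sub, hε x]
    rcases hs x with h0 | ⟨p, hp, hp'⟩
    · left
      rw [Finset.sum_eq_zero fun p _ => if_neg fun h' => h0 p h'.1, sub_zero]
    · have hz : ∀ p' ∈ Finset.univ, p' ≠ p → ¬ slack x p' := fun p' _ hne h' => hne (hp' p' h')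
      rw [Finset.sum_eq_single p (fun p' h1 hne => if_neg fun h' => hz p' h1 hne h'.1)
        (fun h' => absurd (Finset.mem_univ p) h')]
      by_cases he : ε p.1 p.2
      · right
        beta_reduce
        rw [if_pos ⟨hp, he⟩, Set.mem_singleton_iff,
          Finset.sum_eq_single p (fun p' h1 hne => if_neg (hz p' h1 hne))
          (fun h' => absurd (Finset.mem_univ p) h'), if_pos hp]
      · left
        rw [if_neg fun h' => he h'.2, sub_zero]

/-! ### Target residues and shifts along a matching -/

/-- Each index uses at most two residues, at most 4m - 2 uses in all, whereas 128 full classes would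
need 128((m - 1)/32 + 1) ≥ 4m. -/
theorem card_full_classes_le {W R : Type*} [DecidableEq W] [DecidableEq R] [Fintype R] (m : ℕ)
    (T : Finset W) (hT : T.card + 1 ≤ 2 * m) (t t' : W → R) :
    (Finset.univ.filter fun r =>
      (m - 1) / 32 + 1 ≤ (T.filter fun y => r = t y ∨ r = t' y).card).card ≤ 127 := by
  set F := Finset.univ.filter fun r =>
      (m - 1) / 32 + 1 ≤ (T.filter fun y => r = t y ∨ r = t' y).card with hF
  have h1 : F.card * ((m - 1) / 32 + 1) ≤
      ∑ r ∈ F, (T.filter fun y => r = t y ∨ r = t' y).card := by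
    rw [← smul_eq_mul]
    exact Finset.card_nsmul_le_sum _ _ _ fun r hr => (Finset.mem_filter.1 hr).2
  have h2 : ∑ r ∈ F, (T.filter fun y => r = t y ∨ r = t' y).card ≤ T.card * 2 := by
    simp only [Finset.card_filter]
    rw [Finset.sum_comm, ← smul_eq_mul]
    refine Finset.sum_le_card_nsmul _ _ _ fun y _ => ?_
    rw [← Finset.card_filter]
    calc _ ≤ ({t y, t' y} : Finset R).card := Finset.card_le_card fun r hr => by
            simpa using (Finset.mem_filter.1 hr).2
      _ ≤ 2 := Finset.card_le_two
  by_contra hc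
  push Not at hc
  have h3 : 128 * ((m - 1) / 32 + 1) ≤ F.card * ((m - 1) / 32 + 1) := Nat.mul_le_mul_right _ hc
  omega

/-- Greedy choice of residue pairs `{t x, t x - σ x}` that avoid the set `X`, are disjoint for
`(i, false)` and `(i, true)`, and such that every residue is used by few indices. -/
theorem exists_spread_targets {ι : Type*} [Fintype ι] [DecidableEq ι] {M : ℕ} [NeZero M]
    (X : Finset (ZMod M)) (hX : 2 * (129 + X.card) < M) (σ : ι × Bool → ZMod M) :
    ∃ t : ι × Bool → ZMod M, (∀ x, t x ∉ X ∧ t x - σ x ∉ X) ∧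
      (∀ i, Disjoint ({t (i, false), t (i, false) - σ (i, false)} : Finset (ZMod M))
        {t (i, true), t (i, true) - σ (i, true)}) ∧
      ∀ r, (Finset.univ.filter fun x => r = t x ∨ r = t x - σ x).card ≤
        (Fintype.card ι - 1) / 32 + 1 := by
  classical
  set m := Fintype.card ι
  have key : ∀ T : Finset (ι × Bool), ∃ t : ι × Bool → ZMod M,
      (∀ x ∈ T, t x ∉ X ∧ t x - σ x ∉ X) ∧
      (∀ i b, (i, b) ∈ T → (i, !b) ∈ T →
        Disjoint ({t (i, b), t (i, b) - σ (i, b)} : Finset (ZMod M))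
          {t (i, !b), t (i, !b) - σ (i, !b)}) ∧
      ∀ r, (T.filter fun x => r = t x ∨ r = t x - σ x).card ≤ (m - 1) / 32 + 1 := by
    intro T
    induction T using Finset.induction_on with
    | empty => exact ⟨fun _ => 0, by simp, by simp, by simp⟩
    | insert x T hx ih =>
      obtain ⟨t, h1, h2, h3⟩ := ih
      have hcard : T.card + 1 ≤ 2 * m := by
        rw [← Finset.card_insert_of_notMem hx]
        refine (Finset.card_le_univ _).trans ?_
        simp [m, mul_comm]
      set F := Finset.univ.filter fun r =>
        (m - 1) / 32 + 1 ≤ (T.filter fun y => r = t y ∨ r = t y - σ y).card with hF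
      have hFc : F.card ≤ 127 := card_full_classes_le m T hcard t fun y => t y - σ y
      set y : ι × Bool := (x.1, !x.2) with hy
      -- Besides X, the at most 127 full residues and the two residues of the partner are forbidden.
      -- Both r and r - σ x must avoid these, which costs twice 129 + |X|.
      set Z := X ∪ F ∪ {t y, t y - σ y} with hZ
      have hZc : Z.card ≤ X.card + 127 + 2 :=
        (Finset.card_union_le _ _).trans
          (add_le_add ((Finset.card_union_le _ _).trans (by omega)) Finset.card_le_two)
      obtain ⟨r, hr⟩ : ∃ r, r ∉ Z ∪ Z.image (· + σ x) := by
        by_contra! hall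
        have h4 : (Finset.univ : Finset (ZMod M)).card ≤ (Z ∪ Z.image (· + σ x)).card :=
          Finset.card_le_card fun r _ => hall r
        rw [Finset.card_univ, ZMod.card] at h4
        have h5 := Finset.card_union_le Z (Z.image (· + σ x))
        have h6 := Finset.card_image_le (s := Z) (f := (· + σ x))
        omega
      rw [Finset.mem_union, not_or] at hr
      have hr2 : r - σ x ∉ Z := fun h => hr.2 (Finset.mem_image.2 ⟨_, h, by simp⟩)
      have hr1 := hr.1
      simp only [hZ, Finset.mem_union, not_or, Finset.mem_insert, Finset.mem_singleton] at hr1 hr2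
      have hne : ∀ z ∈ T, z ≠ x := fun z hz h => hx (h ▸ hz)
      have hyx : y ≠ x := fun h => by
        have := congrArg Prod.snd h
        simp [hy] at this
      refine ⟨Function.update t x r, ?_, ?_, ?_⟩
      · intro z hz
        rcases Finset.mem_insert.1 hz with rfl | hz
        · simp only [Function.update_self]
          exact ⟨hr1.1.1, hr2.1.1⟩
        · rw [Function.update_of_ne (hne z hz)]
          exact h1 z hz
      · have hxy : Disjoint ({r, r - σ x} : Finset (ZMod M)) {t y, t y - σ y} := by
          rw [Finset.disjoint_left]
          intro a ha hb
          simp only [Finset.mem_insert, Finset.mem_singleton] at ha hb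
          rcases ha with rfl | rfl
          · exact hb.elim hr1.2.1 hr1.2.2
          · exact hb.elim hr2.2.1 hr2.2.2
        intro i b hb hb'
        by_cases e1 : (i, b) = x
        · subst e1
          rw [Function.update_self, Function.update_of_ne (show (i, !b) ≠ (i, b) from hyx)]
          exact hxy
        · by_cases e2 : (i, !b) = x
          · have e3 : (i, b) = y := by rw [hy, ← e2]; simp
            rw [e2, e3, Function.update_self, Function.update_of_ne hyx]
            exact hxy.symm
          · rw [Function.update_of_ne e1, Function.update_of_ne e2]
            exact h2 i b (Finset.mem_of_mem_insert_of_ne hb e1)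
              (Finset.mem_of_mem_insert_of_ne hb' e2)
      · intro a
        have h4 : (T.filter fun z => a = Function.update t x r z ∨
            a = Function.update t x r z - σ z) = T.filter fun z => a = t z ∨ a = t z - σ z := by
          refine Finset.filter_congr fun z hz => ?_
          rw [Function.update_of_ne (hne z hz)]
        rw [Finset.filter_insert, h4, Function.update_self]
        split_ifs with h5
        · have h6 : a ∉ F := by
            rcases h5 with rfl | rfl
            · exact hr1.1.2
            · exact hr2.1.2
          rw [hF, Finset.mem_filter, not_and] at h6
          have h7 := h6 (Finset.mem_univ _)
          have h8 := Finset.card_insert_le x (T.filter fun z => a = t z ∨ a = t z - σ z)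
          omega
        · exact h3 a
  obtain ⟨t, h1, h2, h3⟩ := key Finset.univ
  exact ⟨t, fun x => h1 x (Finset.mem_univ _),
    fun i => h2 i false (Finset.mem_univ _) (Finset.mem_univ _), h3⟩

/-- The labels off the selected edges are fixed before those on them, so the latter can be permuted
later without disturbing the rest. -/
theorem exists_bijOn_extend {α S : Type*} [Fintype S] (E : Finset α) (L T : Finset ℤ)
    (hEL : L.card = E.card) (hT : T ⊆ L) (ed : S → α) (hed : Function.Injective ed)
    (hE : ∀ s, ed s ∈ E) (hcard : T.card = Fintype.card S) :
    ∃ f₀ : α → ℤ, ∀ l : S → ℤ, Function.Injective l → (∀ s, l s ∈ T) →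
      Set.BijOn (Function.extend ed l f₀) E L := by
  classical
  have hsub : Finset.univ.image ed ⊆ E := by
    intro e he
    obtain ⟨s, -, rfl⟩ := Finset.mem_image.1 he
    exact hE s
  have hc : (E \ Finset.univ.image ed).card = (L \ T).card := by
    rw [Finset.card_sdiff_of_subset hsub, Finset.card_sdiff_of_subset hT,
      Finset.card_image_of_injective _ hed, Finset.card_univ, hcard, hEL]
  let eqv := Finset.equivOfCardEq hc
  refine ⟨fun e => if h : e ∈ E \ Finset.univ.image ed then (eqv ⟨e, h⟩ : ℤ) else 0,
    fun l hl hlT => ?_⟩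
  set f₀ : α → ℤ := fun e => if h : e ∈ E \ Finset.univ.image ed then (eqv ⟨e, h⟩ : ℤ) else 0
  have hin : ∀ s, Function.extend ed l f₀ (ed s) = l s := fun s => hed.extend_apply _ _ _
  have hout : ∀ e (h : e ∈ E \ Finset.univ.image ed),
      Function.extend ed l f₀ e = eqv ⟨e, h⟩ := by
    intro e h
    have h' : ¬ ∃ s, ed s = e := by
      rintro ⟨s, rfl⟩
      exact (Finset.mem_sdiff.1 h).2 (Finset.mem_image_of_mem _ (Finset.mem_univ s))
    rw [Function.extend_apply' _ _ _ h']
    exact dif_pos h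
  have hcases : ∀ e ∈ E, (∃ s, e = ed s) ∨ e ∈ E \ Finset.univ.image ed := by
    intro e he
    by_cases h : ∃ s, e = ed s
    · exact Or.inl h
    · refine Or.inr (Finset.mem_sdiff.2 ⟨he, fun h' => h ?_⟩)
      obtain ⟨s, -, hs⟩ := Finset.mem_image.1 h'
      exact ⟨s, hs.symm⟩
  have hmaps : Set.MapsTo (Function.extend ed l f₀) E L := by
    intro e he
    rcases hcases e he with ⟨s, rfl⟩ | h
    · rw [hin]
      exact hT (hlT s)
    · rw [hout e h]
      exact (Finset.mem_sdiff.1 (eqv ⟨e, h⟩).2).1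
  have hinj : Set.InjOn (Function.extend ed l f₀) E := by
    intro e he e' he' hee
    rcases hcases e he with ⟨s, rfl⟩ | h <;> rcases hcases e' he' with ⟨s', rfl⟩ | h'
    · rw [hin, hin] at hee
      rw [hl hee]
    · rw [hin, hout e' h'] at hee
      exact absurd (hee ▸ hlT s) (Finset.mem_sdiff.1 (eqv ⟨e', h'⟩).2).2
    · rw [hin, hout e h] at hee
      exact absurd (hee ▸ hlT s') (Finset.mem_sdiff.1 (eqv ⟨e, h⟩).2).2
    · rw [hout e h, hout e' h'] at hee
      exact congrArg Subtype.val (eqv.injective (Subtype.ext hee))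
  exact ⟨hmaps, hinj, Finset.surjOn_of_injOn_of_card_le _ hmaps hinj hEL.le⟩

theorem vertexSum_extend {V : Type*} [Fintype V] [DecidableEq V] (G : SimpleGraph V)
    [DecidableRel G.Adj] {S : Type*} [Fintype S] (ed : S → Sym2 V) (hed : Function.Injective ed)
    (hE : ∀ s, ed s ∈ G.edgeFinset) (l : S → ℤ) (f₀ : Sym2 V → ℤ) (g : V → ℕ) (x : V) :
    vertexSum G (Function.extend ed l f₀) g x =
      ((g x : ℤ) + ∑ e ∈ G.incidenceFinset x \ Finset.univ.image ed, f₀ e) +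
        ∑ s, if x ∈ ed s then l s else 0 := by
  classical
  have h1 : ∑ s, (if x ∈ ed s then l s else 0) =
      ∑ e ∈ G.incidenceFinset x ∩ Finset.univ.image ed, Function.extend ed l f₀ e := by
    rw [← Finset.sum_filter]
    refine Finset.sum_bij (fun s _ => ed s) ?_ (fun s _ s' _ h => hed h) ?_ ?_
    · intro s hs
      rw [Finset.mem_inter, SimpleGraph.mem_incidenceFinset]
      exact ⟨⟨SimpleGraph.mem_edgeFinset.1 (hE s), (Finset.mem_filter.1 hs).2⟩,
        Finset.mem_image_of_mem _ (Finset.mem_univ s)⟩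
    · intro e he
      obtain ⟨h2, h3⟩ := Finset.mem_inter.1 he
      obtain ⟨s, -, rfl⟩ := Finset.mem_image.1 h3
      rw [SimpleGraph.mem_incidenceFinset] at h2
      exact ⟨s, Finset.mem_filter.2 ⟨Finset.mem_univ s, h2.2⟩, rfl⟩
    · intro s _
      rw [hed.extend_apply]
  have h2 : ∑ e ∈ G.incidenceFinset x \ Finset.univ.image ed, f₀ e =
      ∑ e ∈ G.incidenceFinset x \ Finset.univ.image ed, Function.extend ed l f₀ e := by
    refine Finset.sum_congr rfl fun e he => ?_
    rw [Function.extend_apply']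
    rintro ⟨s, rfl⟩
    exact (Finset.mem_sdiff.1 he).2 (Finset.mem_image_of_mem _ (Finset.mem_univ s))
  rw [vertexSum, h1, h2, add_assoc, ← Finset.sum_inter_add_sum_sdiff (G.incidenceFinset x)
    (Finset.univ.image ed)]
  ring

/-- A common shift of both members of each pair by distinct multiples of `B` separates the
members of different pairs, if no residue class contains too many of the values. -/
theorem exists_perm_shift_ne {m : ℕ} (Q : Fin m × Bool → ℤ) (M B : ℤ) (hB : B ≠ 0) (hMB : M ∣ B)
    (hQ : ∀ x, (Finset.univ.filter fun y => y.1 ≠ x.1 ∧ M ∣ Q y - Q x).card ≤ (m - 1) / 32) :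
    ∃ π : Equiv.Perm (Fin m), ∀ x y, x.1 ≠ y.1 →
      Q x + B * ((π x.1 : ℕ) + 1) ≠ Q y + B * ((π y.1 : ℕ) + 1) := by
  classical
  let R : Fin m × Fin m → Fin m × Fin m → Prop := fun c c' => c.1 ≠ c'.1 ∧
    ∃ b b', Q (c.1, b) + B * ((c.2 : ℕ) + 1) = Q (c'.1, b') + B * ((c'.2 : ℕ) + 1)
  -- A cell prescribes a multiple of B for a matching edge. Each of its two ends conflicts only with
  -- values in its class modulo M, each fixing the other cell; two ends and the density 1/32 give
  -- 16D ≤ m - 1.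
  obtain ⟨π, hπ⟩ := exists_perm_no_conflict R (2 * ((m - 1) / 32))
    (fun c c' ⟨h, b, b', h'⟩ => ⟨h.symm, b', b, h'.symm⟩) (fun c c' h => h.1) (by
      intro c
      let N : Bool → Finset (Fin m × Bool) := fun b =>
        Finset.univ.filter fun y => y.1 ≠ c.1 ∧ M ∣ Q y - Q (c.1, b)
      have hch : ∀ c' : {c' // R c c'}, ∃ z : Σ _ : Bool, Fin m × Bool,
          z ∈ Finset.univ.sigma N ∧ z.2.1 = c'.1.1 ∧
          Q (c.1, z.1) + B * ((c.2 : ℕ) + 1) = Q z.2 + B * ((c'.1.2 : ℕ) + 1) := by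
        rintro ⟨c', h, b, b', h'⟩
        refine ⟨⟨b, (c'.1, b')⟩, ?_, rfl, h'⟩
        simp only [Finset.mem_sigma, Finset.mem_univ, true_and, N, Finset.mem_filter]
        refine ⟨h.symm, ?_⟩
        have : Q (c'.1, b') - Q (c.1, b) = B * (((c.2 : ℕ) : ℤ) - (c'.2 : ℕ)) := by linarith
        rw [this]
        exact hMB.mul_right _
      choose z hz1 hz2 hz3 using hch
      have hzinj : Function.Injective z := by
        intro c' c'' h
        have h1 := hz2 c'
        have h2 := hz3 c'
        rw [h, hz2 c''] at h1
        rw [h, hz3 c''] at h2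
        have h3 := mul_left_cancel₀ hB (add_left_cancel h2)
        refine Subtype.ext (Prod.ext h1.symm (Fin.ext ?_))
        have : ((c''.1.2 : ℕ) : ℤ) = (c'.1.2 : ℕ) := by linarith
        exact_mod_cast this.symm
      calc ({c' | R c c'} : Set _).ncard = Fintype.card {c' // R c c'} := by
            rw [← Nat.card_coe_set_eq, Nat.card_eq_fintype_card]
            rfl
        _ = (Finset.univ.image z).card := by
            rw [Finset.card_image_of_injective _ hzinj, Finset.card_univ]
        _ ≤ (Finset.univ.sigma N).card := Finset.card_le_card (by
            intro a ha
            obtain ⟨c', -, rfl⟩ := Finset.mem_image.1 ha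
            exact hz1 c')
        _ = ∑ b, (N b).card := Finset.card_sigma _ _
        _ ≤ 2 * ((m - 1) / 32) := by
            rw [Fintype.sum_bool]
            have h1 := hQ (c.1, true)
            have h2 := hQ (c.1, false)
            exact (add_le_add h1 h2).trans_eq (two_mul _).symm)
    (by rw [Fintype.card_fin]; omega)
  exact ⟨π, fun x y hxy h => hπ x.1 y.1 ⟨hxy, x.2, y.2, h⟩⟩

theorem SimpleGraph.exists_maximal_pairing {V : Type*} [Fintype V] (G : SimpleGraph V) :
    ∃ (m : ℕ) (vx : Fin m × Bool → V), Function.Injective vx ∧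
      (∀ i, G.Adj (vx (i, false)) (vx (i, true))) ∧
      ∀ x y, x ∉ Set.range vx → y ∉ Set.range vx → ¬ G.Adj x y := by
  classical
  let P : ℕ → Prop := fun m => ∃ vx : Fin m × Bool → V, Function.Injective vx ∧
    ∀ i, G.Adj (vx (i, false)) (vx (i, true))
  have hbound : ∀ m, P m → m ≤ Fintype.card V := by
    rintro m ⟨vx, h, -⟩
    have := Fintype.card_le_of_injective vx h
    simp at this
    omega
  have h0 : P 0 := ⟨fun p => p.1.elim0, fun p => p.1.elim0, fun i => i.elim0⟩
  have hm := Nat.findGreatest_spec (P := P) (Nat.zero_le (Fintype.card V)) h0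
  set m := Nat.findGreatest P (Fintype.card V) with hmdef
  obtain ⟨vx, hinj, hadj⟩ := hm
  refine ⟨m, vx, hinj, hadj, fun x y hx hy hxy => ?_⟩
  have : P (m + 1) := by
    refine ⟨fun p => Fin.cases (if p.2 then y else x) (fun i => vx (i, p.2)) p.1, ?_, ?_⟩
    · rintro ⟨i, b⟩ ⟨i', b'⟩ h
      induction i using Fin.cases <;> induction i' using Fin.cases
      · simp only [Fin.cases_zero] at h
        have := hxy.ne
        have := hxy.ne'
        cases b <;> cases b' <;> simp_all
      · simp only [Fin.cases_zero, Fin.cases_succ] at h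
        split_ifs at h
        · exact absurd ⟨_, h.symm⟩ hy
        · exact absurd ⟨_, h.symm⟩ hx
      · simp only [Fin.cases_zero, Fin.cases_succ] at h
        split_ifs at h
        · exact absurd ⟨_, h⟩ hy
        · exact absurd ⟨_, h⟩ hx
      · simp only [Fin.cases_succ] at h
        have := hinj h
        simp_all
    · intro i
      induction i using Fin.cases
      · simpa using hxy
      · simpa using hadj _
  have := Nat.le_findGreatest (hbound _ this) this
  omega

/-! ### Targets on the graph, and the label system -/

theorem card_filter_castHom_eq_zero_le {K M : ℕ} [NeZero M] (hKM : K ∣ M) :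
    (Finset.univ.filter fun r : ZMod M => ZMod.castHom hKM (ZMod K) r = 0).card ≤ M / K := by
  have : (Finset.univ.filter fun r : ZMod M => ZMod.castHom hKM (ZMod K) r = 0) ⊆
      (Finset.range (M / K)).image fun i => ((K * i : ℕ) : ZMod M) := by
    intro r hr
    have h1 := (Finset.mem_filter.1 hr).2
    rw [← ZMod.natCast_zmod_val r, map_natCast, ZMod.natCast_eq_zero_iff] at h1
    obtain ⟨i, hi⟩ := h1
    refine Finset.mem_image.2 ⟨i, Finset.mem_range.2 ?_, ?_⟩
    · have h2 := ZMod.val_lt r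
      obtain ⟨d, hd⟩ := hKM
      have hK : 0 < K := Nat.pos_of_ne_zero fun h => NeZero.ne M (by rw [hd, h, zero_mul])
      rw [hd, Nat.mul_div_cancel_left _ hK]
      have h3 : K * i < K * d := by omega
      exact Nat.lt_of_mul_lt_mul_left h3
    · rw [← hi, ZMod.natCast_zmod_val]
  refine (Finset.card_le_card this).trans (Finset.card_image_le.trans ?_)
  rw [Finset.card_range]

/-- Residue pairs `{t x, t x - σ x}` consisting of residues not divisible by `K`, separating the
vertices outside the image of `vx` from those inside. -/
theorem exists_targets {V : Type*} [DecidableEq V] {m K M q : ℕ} [NeZero M] (hKM : K ∣ M)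
    (hq : q + 1 < K) (hX : 2 * (129 + (M / K + (q + 1))) < M) (vx : Fin m × Bool → V)
    (hvx : Function.Injective vx) (σ : V → ZMod M)
    (hσ : ∀ x, σ x = 0 ∨ ∃ j : Fin q, σ x = 2 ^ (j : ℕ)) :
    ∃ t : V → ZMod M,
      (∀ x, ∀ n : ℤ, (n : ZMod M) = t x ∨ (n : ZMod M) = t x - σ x → ¬ (K : ℤ) ∣ n) ∧
      (∀ x p, x ∉ Set.range vx → Disjoint ({t x, t x - σ x} : Set (ZMod M))
        {t (vx p), t (vx p) - σ (vx p)}) ∧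
      (∀ i, Disjoint ({t (vx (i, false)), t (vx (i, false)) - σ (vx (i, false))} : Set (ZMod M))
        {t (vx (i, true)), t (vx (i, true)) - σ (vx (i, true))}) ∧
      ∀ r, (Finset.univ.filter fun p => r = t (vx p) ∨ r = t (vx p) - σ (vx p)).card ≤
        (m - 1) / 32 + 1 := by
  classical
  have : NeZero K := ⟨by omega⟩
  let φ := ZMod.castHom hKM (ZMod K)
  -- All unmatched vertices share the target r₀ lifting s. As s is neither 0 nor a 2^j modulo K, no
  -- r₀ - σ x is divisible by K either; matched vertices avoid the set `RI` of all these values.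
  obtain ⟨s, hs⟩ : ∃ s : ZMod K,
      s ∉ insert 0 ((Finset.univ : Finset (Fin q)).image fun j : Fin q => (2 : ZMod K) ^ (j : ℕ)) := by
    by_contra! hall
    have h1 : (Finset.univ : Finset (ZMod K)).card ≤ _ := Finset.card_le_card fun s _ => hall s
    rw [Finset.card_univ, ZMod.card] at h1
    have h2 := Finset.card_insert_le (0 : ZMod K)
      ((Finset.univ : Finset (Fin q)).image fun j : Fin q => (2 : ZMod K) ^ (j : ℕ))
    have h3 := Finset.card_image_le (s := (Finset.univ : Finset (Fin q)))
      (f := fun j : Fin q => (2 : ZMod K) ^ (j : ℕ))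
    rw [Finset.card_univ, Fintype.card_fin] at h3
    omega
  simp only [Finset.mem_insert, Finset.mem_image, Finset.mem_univ, true_and, not_or,
    not_exists] at hs
  set r₀ : ZMod M := (s.val : ZMod M) with hr₀
  have hφ : φ r₀ = s := by
    rw [hr₀, map_natCast, ZMod.natCast_zmod_val]
  set Z : Finset (ZMod M) := Finset.univ.filter fun r => φ r = 0 with hZ
  set RI : Finset (ZMod M) := insert r₀
    ((Finset.univ : Finset (Fin q)).image fun j : Fin q => r₀ - (2 : ZMod M) ^ (j : ℕ)) with hRI
  have hXc : (Z ∪ RI).card ≤ M / K + (q + 1) := by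
    refine (Finset.card_union_le _ _).trans (add_le_add (card_filter_castHom_eq_zero_le hKM) ?_)
    refine (Finset.card_insert_le _ _).trans (Nat.succ_le_succ (Finset.card_image_le.trans ?_))
    rw [Finset.card_univ, Fintype.card_fin]
  obtain ⟨tU, h1, h2, h3⟩ := exists_spread_targets (ι := Fin m) (Z ∪ RI) (by omega)
    fun p => σ (vx p)
  have hin : ∀ p, Function.extend vx tU (fun _ => r₀) (vx p) = tU p :=
    fun p => hvx.extend_apply _ _ _
  have hout : ∀ x, x ∉ Set.range vx → Function.extend vx tU (fun _ => r₀) x = r₀ :=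
    fun x hx => Function.extend_apply' _ _ _ hx
  have hRI0 : ∀ r ∈ RI, φ r ≠ 0 := by
    intro r hr
    rcases Finset.mem_insert.1 hr with rfl | hr
    · rw [hφ]
      exact hs.1
    · obtain ⟨j, -, rfl⟩ := Finset.mem_image.1 hr
      rw [map_sub, hφ, map_pow, map_ofNat, sub_ne_zero]
      exact fun h => hs.2 j h.symm
  have hσRI : ∀ x, r₀ - σ x ∈ RI := by
    intro x
    rcases hσ x with h | ⟨j, h⟩
    · rw [h, sub_zero]
      exact Finset.mem_insert_self _ _
    · rw [h]
      exact Finset.mem_insert_of_mem (Finset.mem_image_of_mem _ (Finset.mem_univ j))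
  have hdvd : ∀ n : ℤ, φ (n : ZMod M) ≠ 0 → ¬ (K : ℤ) ∣ n := by
    intro n hn hK
    rw [map_intCast] at hn
    exact hn ((ZMod.intCast_zmod_eq_zero_iff_dvd n K).2 hK)
  refine ⟨Function.extend vx tU fun _ => r₀, ?_, ?_, ?_, ?_⟩
  · intro x n hn
    refine hdvd n ?_
    by_cases hx : x ∈ Set.range vx
    · obtain ⟨p, rfl⟩ := hx
      rw [hin] at hn
      have h4 : (n : ZMod M) ∉ Z ∪ RI := by
        rcases hn with h | h <;> rw [h]
        · exact (h1 p).1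
        · exact (h1 p).2
      intro h5
      exact h4 (Finset.mem_union_left _ (Finset.mem_filter.2 ⟨Finset.mem_univ _, h5⟩))
    · rw [hout x hx] at hn
      refine hRI0 _ ?_
      rcases hn with h | h <;> rw [h]
      · exact Finset.mem_insert_self _ _
      · exact hσRI x
  · intro x p hx
    rw [hin, hout x hx, Set.disjoint_left]
    intro r hr hr'
    have h4 : r ∈ RI := by
      rcases hr with rfl | rfl
      · exact Finset.mem_insert_self _ _
      · exact hσRI x
    rcases hr' with rfl | rfl
    · exact (h1 p).1 (Finset.mem_union_right _ h4)
    · exact (h1 p).2 (Finset.mem_union_right _ h4)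
  · intro i
    rw [hin, hin]
    simpa using Finset.disjoint_coe.2 (h2 i)
  · intro r
    simp only [hin]
    simpa using h3 r

theorem exists_injective_add {ι : Type*} [Fintype ι] (P Z : ι → ℤ) (hZ : Function.Injective Z) :
    ∃ τ : ι → ι, Function.Injective τ ∧ Function.Injective fun x => P x + Z (τ x) := by
  classical
  obtain ⟨y, hy, hinj⟩ := exists_bijOn_injOn_add P Finset.univ (Finset.univ.image Z)
    (Finset.card_image_of_injective _ hZ)
  have h : ∀ x, ∃ x', Z x' = y x := by
    intro x
    simpa using hy.mapsTo (Finset.mem_coe.2 (Finset.mem_univ x))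
  choose τ hτ using h
  refine ⟨τ, fun x x' h => ?_, fun x x' h => ?_⟩
  · refine hy.injOn (Finset.mem_coe.2 (Finset.mem_univ x)) (Finset.mem_coe.2 (Finset.mem_univ x')) ?_
    rw [← hτ, ← hτ, h]
  · simp only [hτ] at h
    exact hinj (Finset.mem_coe.2 (Finset.mem_univ x)) (Finset.mem_coe.2 (Finset.mem_univ x')) h

/-- Swapping the labels `b` and `b + 2 ^ j` of the two edges of a path `v, w v j, u v j` changes
the sums at the endpoints only. -/
theorem sum_toggle {V : Type*} [Fintype V] [DecidableEq V] {q : ℕ} (w u : V → Fin q → V)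
    (hvw : ∀ v j, v ≠ w v j) (huw : ∀ v j, u v j ≠ w v j) (hvu : ∀ v j, v ≠ u v j)
    (ed : (V × Fin q) × Bool → Sym2 V) (hed₀ : ∀ v j, ed ((v, j), false) = s(v, w v j))
    (hed₁ : ∀ v j, ed ((v, j), true) = s(u v j, w v j)) (lab : (V × Fin q) × Bool → ℤ)
    (hlab : ∀ p, lab (p, true) = lab (p, false) + 2 ^ (p.2 : ℕ)) (ε : V → Fin q → Bool) (x : V) :
    (∑ γ, if x ∈ ed γ then lab (γ.1, xor γ.2 (ε γ.1.1 γ.1.2)) else 0) =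
      (∑ γ, if x ∈ ed γ then lab γ else 0) +
        (∑ j, if ε x j then (2 : ℤ) ^ (j : ℕ) else 0) -
        ∑ p : V × Fin q, if u p.1 p.2 = x ∧ ε p.1 p.2 then (2 : ℤ) ^ (p.2 : ℕ) else 0 := by
  have h1 : (∑ j, if ε x j then (2 : ℤ) ^ (j : ℕ) else 0) =
      ∑ p : V × Fin q, if p.1 = x ∧ ε p.1 p.2 then (2 : ℤ) ^ (p.2 : ℕ) else 0 := by
    rw [Fintype.sum_prod_type, Finset.sum_eq_single x]
    · simp
    · intro v _ hv
      simp [hv]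
    · intro h
      exact absurd (Finset.mem_univ x) h
  rw [h1, Fintype.sum_prod_type, Fintype.sum_prod_type (f := fun γ : (V × Fin q) × Bool =>
    if x ∈ ed γ then lab γ else 0), ← Finset.sum_add_distrib, ← Finset.sum_sub_distrib]
  refine Finset.sum_congr rfl fun p _ => ?_
  obtain ⟨v, j⟩ := p
  have a1 := hvw v j
  have a2 := huw v j
  have a3 := hvu v j
  simp only [Fintype.sum_bool, hed₀, hed₁, Sym2.mem_iff, Bool.true_xor, Bool.false_xor]
  cases hε : ε v j
  · simp
  · have e1 := hlab (v, j)
    simp only [Bool.not_true, and_true, e1]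
    by_cases b1 : x = v
    · subst b1
      simp [a1, a3, a3.symm]
    · by_cases b2 : x = u v j
      · subst b2
        simp [a2, a3, b1]
      · have b1' : ¬ v = x := fun h => b1 h.symm
        have b2' : ¬ u v j = x := fun h => b2 h.symm
        by_cases b3 : x = w v j
        · subst b3
          simp [a1, a2, b1, b2]
          ring
        · simp [b1, b2, b3, b1', b2']

/-- Labels of the toggled edges (residues `a j`, `a j + 2 ^ j` in blocks of length `B`) and
multiples of `B` are distinct. -/
theorem injective_labels {W ι κ : Type*} {q B m : ℕ} (hB : 0 < B) (idx : W → ℕ)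
    (hidx : Function.Injective idx) (a : Fin q → ℕ)
    (ha : Function.Injective fun p : Fin q × Bool => a p.1 + if p.2 then 2 ^ (p.1 : ℕ) else 0)
    (hapos : ∀ j, 0 < a j) (haB : ∀ j, a j + 2 ^ (j : ℕ) < B) (i₁ : ι → ℕ)
    (hi₁ : Function.Injective i₁) (hm : ∀ i, i₁ i < m) (i₂ : κ → ℕ) (hi₂ : Function.Injective i₂) :
    Function.Injective (Sum.elim
      (fun γ : (W × Fin q) × Bool =>
        ((B * idx γ.1.1 + (a γ.1.2 + if γ.2 then 2 ^ (γ.1.2 : ℕ) else 0) : ℕ) : ℤ))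
      (Sum.elim (fun i : ι => (B : ℤ) * ((i₁ i : ℤ) + 1))
        fun k : κ => (B : ℤ) * (((m + i₂ k : ℕ) : ℤ) + 1))) := by
  have hr : ∀ γ : (W × Fin q) × Bool, 0 < (a γ.1.2 + if γ.2 then 2 ^ (γ.1.2 : ℕ) else 0) ∧
      (a γ.1.2 + if γ.2 then 2 ^ (γ.1.2 : ℕ) else 0) < B := by
    intro γ
    have h1 := hapos γ.1.2
    have h2 := haB γ.1.2
    have h3 := Nat.two_pow_pos (γ.1.2 : ℕ)
    split_ifs
    · exact ⟨by omega, h2⟩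
    · exact ⟨by omega, by omega⟩
  have hne : ∀ (γ : (W × Fin q) × Bool) (k : ℕ),
      ((B * idx γ.1.1 + (a γ.1.2 + if γ.2 then 2 ^ (γ.1.2 : ℕ) else 0) : ℕ) : ℤ) ≠
        (B : ℤ) * ((k : ℤ) + 1) := by
    intro γ k h
    have h1 : B * idx γ.1.1 + (a γ.1.2 + if γ.2 then 2 ^ (γ.1.2 : ℕ) else 0) = B * (k + 1) := by
      exact_mod_cast h
    have h2 := congrArg (· % B) h1
    simp only [Nat.mul_add_mod, Nat.mul_mod_right, Nat.mod_eq_of_lt (hr γ).2] at h2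
    exact (hr γ).1.ne' h2
  have hBz : (B : ℤ) ≠ 0 := by exact_mod_cast hB.ne'
  refine Function.Injective.sumElim ?_ (Function.Injective.sumElim ?_ ?_ ?_) ?_
  · intro γ γ' h
    have h1 : B * idx γ.1.1 + (a γ.1.2 + if γ.2 then 2 ^ (γ.1.2 : ℕ) else 0) =
        B * idx γ'.1.1 + (a γ'.1.2 + if γ'.2 then 2 ^ (γ'.1.2 : ℕ) else 0) :=
      Nat.cast_injective (R := ℤ) h
    have h2 := congrArg (· % B) h1
    simp only [Nat.mul_add_mod, Nat.mod_eq_of_lt (hr γ).2, Nat.mod_eq_of_lt (hr γ').2] at h2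
    rw [h2] at h1
    have h3 := hidx (Nat.eq_of_mul_eq_mul_left hB (Nat.add_right_cancel h1))
    have h4 := Prod.ext_iff.1 (@ha (γ.1.2, γ.2) (γ'.1.2, γ'.2) h2)
    exact Prod.ext (Prod.ext h3 h4.1) h4.2
  · intro i i' h
    have := mul_left_cancel₀ hBz h
    exact hi₁ (by omega)
  · intro i i' h
    have := mul_left_cancel₀ hBz h
    exact hi₂ (by omega)
  · intro i k h
    have := mul_left_cancel₀ hBz h
    have := hm i
    omega
  · rintro γ (i | k)
    · exact hne γ _
    · exact hne γ _

/-! ### Assembly and choice of constants -/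

-- Each vertex owns a block of B consecutive labels, in which the toggle with index j uses offsets
-- `a j` and `a j + 2 ^ j`. These offsets are positive and below B, leaving the multiples of B free
-- for matching and private edges. The extra 1 in the degree bound pays for the matching edge at a
-- vertex.
set_option maxHeartbeats 1000000 in
theorem constantsWork_of_parameters {k₁ k₂ c δ M q B : ℕ} (hKM : k₁ * k₂ ∣ M) (hM : 0 < M)
    (hMB : M ∣ B) (hB : 0 < B) (hBc : B ≤ c) (hMq : M ≤ 2 ^ q) (hq0 : 0 < q) (hq : q + 1 < k₁ * k₂)
    (hX : 2 * (129 + (M / (k₁ * k₂) + (q + 1))) < M)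
    (hδ : 2 * (8 * q * q + 6 * q + (4 * q + 3)) + 1 ≤ δ) (a : Fin q → ℕ)
    (ha : Function.Injective fun p : Fin q × Bool => a p.1 + if p.2 then 2 ^ (p.1 : ℕ) else 0)
    (hapos : ∀ j, 0 < a j) (haB : ∀ j, a j + 2 ^ (j : ℕ) < B) :
    ConstantsWork.{u} k₁ k₂ c δ := by
  classical
  intro V _ _ G _ hG L hL hcL g
  have : NeZero M := ⟨hM.ne'⟩
  have hMBz : (M : ℤ) ∣ (B : ℤ) := Int.natCast_dvd_natCast.2 hMB
  obtain ⟨m, vx, hvx, hadj, hmax⟩ := G.exists_maximal_pairing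
  let me : Fin m → Sym2 V := fun i => s(vx (i, false), vx (i, true))
  have hme : ∀ i x, x ∈ me i ↔ ∃ b, x = vx (i, b) := by
    intro i x
    simp only [me, Sym2.mem_iff, Bool.exists_bool]
  have hme' : ∀ i p, vx p ∈ me i ↔ p.1 = i := by
    rintro i ⟨i', b⟩
    rw [hme]
    constructor
    · rintro ⟨b', h⟩
      exact congrArg Prod.fst (hvx h)
    · rintro rfl
      exact ⟨b, rfl⟩
  have hme_inj : Function.Injective me := by
    intro i i' h
    exact (hme' i' (i, false)).1 (h ▸ (hme' i (i, false)).2 rfl)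
  have hme_mem : ∀ i, me i ∈ G.edgeFinset := fun i => SimpleGraph.mem_edgeFinset.2 (hadj i)
  obtain ⟨e, w, u, rank, he, heinj, hwu, hew, hα, hβ, hαβ, hslack⟩ :=
    exists_control_system q hq0 (G.edgeFinset \ Finset.univ.image me)
      (fun e he => G.not_isDiag_of_mem_edgeFinset (Finset.mem_sdiff.1 he).1) (by
        intro v
        have h1 : δ ≤ (G.incidenceFinset v).card := by
          rw [G.card_incidenceFinset_eq_degree]
          exact hG.trans (G.minDegree_le_degree v)
        have h2 : G.incidenceFinset v ⊆
            ((G.edgeFinset \ Finset.univ.image me).filter fun e => v ∈ e) ∪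
              ((Finset.univ.filter fun i => v ∈ me i).image me) := by
          intro e he
          rw [SimpleGraph.mem_incidenceFinset] at he
          by_cases h : e ∈ Finset.univ.image me
          · obtain ⟨i, -, rfl⟩ := Finset.mem_image.1 h
            exact Finset.mem_union_right _ (Finset.mem_image_of_mem _
              (Finset.mem_filter.2 ⟨Finset.mem_univ _, he.2⟩))
          · exact Finset.mem_union_left _ (Finset.mem_filter.2
              ⟨Finset.mem_sdiff.2 ⟨SimpleGraph.mem_edgeFinset.2 he.1, h⟩, he.2⟩)
        have h3 : (Finset.univ.filter fun i => v ∈ me i).card ≤ 1 := by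
          refine Finset.card_le_one.2 fun i hi i' hi' => ?_
          obtain ⟨b, rfl⟩ := (hme i v).1 (Finset.mem_filter.1 hi).2
          exact (hme' i' (i, b)).1 (Finset.mem_filter.1 hi').2
        have h4 := (Finset.card_le_card h2).trans (Finset.card_union_le _ _)
        have h5 := Finset.card_image_le (s := Finset.univ.filter fun i => v ∈ me i) (f := me)
        omega)
  have hAE : ∀ x ∈ G.edgeFinset \ Finset.univ.image me, x ∈ G.edgeFinset ∧ ∀ i, x ≠ me i := by
    intro x hx
    obtain ⟨h1, h2⟩ := Finset.mem_sdiff.1 hx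
    exact ⟨h1, fun i h => h2 (h ▸ Finset.mem_image_of_mem _ (Finset.mem_univ i))⟩
  let I := {v : V // v ∉ Set.range vx}
  let eΓ : (V × Fin q) × Bool → Sym2 V :=
    fun γ => if γ.2 then s(u γ.1.1 γ.1.2, w γ.1.1 γ.1.2) else s(γ.1.1, w γ.1.1 γ.1.2)
  have heΓA : ∀ γ, eΓ γ ∈ G.edgeFinset \ Finset.univ.image me := by
    rintro ⟨⟨v, j⟩, _ | _⟩
    · exact (hwu v j).1
    · exact (hwu v j).2.1
  have heΓinj : Function.Injective eΓ := by
    rintro ⟨⟨v, j⟩, _ | _⟩ ⟨⟨v', j'⟩, _ | _⟩ h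
    · obtain ⟨rfl, rfl⟩ := hα v j v' j' h
      rfl
    · exact absurd h (hαβ v j v' j')
    · exact absurd h.symm (hαβ v' j' v j)
    · obtain ⟨rfl, rfl⟩ := hβ v j v' j' h
      rfl
  have heeΓ : ∀ x γ, e x ≠ eΓ γ := by
    rintro x ⟨⟨v, j⟩, _ | _⟩
    · exact (hew x v j).1
    · exact (hew x v j).2
  let ed : (V × Fin q) × Bool ⊕ (Fin m ⊕ I) → Sym2 V := Sum.elim eΓ (Sum.elim me fun x => e x)
  have hed : Function.Injective ed := by
    refine heΓinj.sumElim (hme_inj.sumElim (fun x y h => Subtype.ext (heinj h)) ?_) ?_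
    · exact fun i x h => (hAE _ (he x).1).2 i h.symm
    · rintro γ (i | x)
      · exact (hAE _ (heΓA γ)).2 i
      · exact (heeΓ x γ).symm
  have hedE : ∀ s, ed s ∈ G.edgeFinset := by
    rintro (γ | i | x)
    · exact (hAE _ (heΓA γ)).1
    · exact hme_mem i
    · exact (hAE _ (he x).1).1
  let idx := Fintype.equivFin V
  let idI := Fintype.equivFin I
  let lab : (V × Fin q) × Bool → ℤ := fun γ =>
    ((B * (idx γ.1.1 : ℕ) + (a γ.1.2 + if γ.2 then 2 ^ (γ.1.2 : ℕ) else 0) : ℕ) : ℤ)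
  -- The first m multiples of B are kept for the matching. Since m + |I| ≤ |V|, the largest multiple
  -- used is at most B|V|.
  let Z : I → ℤ := fun x => (B : ℤ) * (((m + (idI x : ℕ) : ℕ) : ℤ) + 1)
  let l₀ : (V × Fin q) × Bool ⊕ (Fin m ⊕ I) → ℤ :=
    Sum.elim lab (Sum.elim (fun i => (B : ℤ) * (((i : ℕ) : ℤ) + 1)) Z)
  have hl₀ : Function.Injective l₀ :=
    injective_labels hB (fun v => (idx v : ℕ)) (fun v v' h => idx.injective (Fin.ext h)) a ha
      hapos haB (fun i : Fin m => (i : ℕ)) Fin.val_injective (fun i => i.2)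
      (fun x : I => (idI x : ℕ)) fun x y h => idI.injective (Fin.ext h)
  have hmI : m + Fintype.card I ≤ Fintype.card V := by
    have : Function.Injective (Sum.elim (fun i : Fin m => vx (i, false)) (Subtype.val : I → V)) :=
      Function.Injective.sumElim (fun i i' h => congrArg Prod.fst (hvx h)) Subtype.val_injective
        fun i x h => x.2 ⟨_, h⟩
    have h := Fintype.card_le_of_injective _ this
    rwa [Fintype.card_sum, Fintype.card_fin] at h
  have hl₀L : ∀ s, l₀ s ∈ L := by
    have hk : ∀ k : ℕ, 0 < k → k ≤ B * Fintype.card V → (k : ℤ) ∈ L := by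
      intro k h1 h2
      refine hcL (Finset.mem_Icc.2 ⟨by exact_mod_cast h1, ?_⟩)
      exact_mod_cast h2.trans (Nat.mul_le_mul_right _ hBc)
    rintro (γ | i | x)
    · have h1 := hapos γ.1.2
      have h2 := haB γ.1.2
      have h3 := Nat.two_pow_pos (γ.1.2 : ℕ)
      have h4 : B * ((idx γ.1.1 : ℕ) + 1) ≤ B * Fintype.card V :=
        Nat.mul_le_mul_left _ (idx γ.1.1).2
      rw [Nat.mul_add, mul_one] at h4
      have h5 : (if γ.2 then 2 ^ (γ.1.2 : ℕ) else 0) ≤ 2 ^ (γ.1.2 : ℕ) := by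
        split_ifs
        · exact le_rfl
        · exact h3.le
      exact hk _ (by omega) (by omega)
    · have h1 : B * ((i : ℕ) + 1) ≤ B * Fintype.card V :=
        Nat.mul_le_mul_left _ (by have := i.2; omega)
      have h2 := hk (B * ((i : ℕ) + 1)) (by positivity) h1
      push_cast at h2
      exact h2
    · have h1 : B * (m + (idI x : ℕ) + 1) ≤ B * Fintype.card V :=
        Nat.mul_le_mul_left _ (by have := (idI x).2; omega)
      have h2 := hk (B * (m + (idI x : ℕ) + 1)) (by positivity) h1
      rw [Nat.cast_mul, Nat.cast_add_one] at h2
      exact h2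
  obtain ⟨σ, hσ, htog⟩ := exists_toggles hMq u rank hslack
  obtain ⟨t, ht1, ht2, ht3, ht4⟩ := exists_targets hKM hq hX vx hvx σ hσ
  obtain ⟨f₀, hf₀⟩ := exists_bijOn_extend G.edgeFinset L (Finset.univ.image l₀) hL
    (by
      intro z hz
      obtain ⟨s, -, rfl⟩ := Finset.mem_image.1 hz
      exact hl₀L s) ed hed hedE (Finset.card_image_of_injective _ hl₀)
  let P₀ : V → ℤ := fun x =>
    (g x : ℤ) + ∑ e ∈ G.incidenceFinset x \ Finset.univ.image ed, f₀ e
  obtain ⟨ε, hε⟩ := htog (fun x => ((P₀ x + ∑ γ, if x ∈ eΓ γ then lab γ else 0 : ℤ) : ZMod M)) t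
  let P : V → ℤ := fun x =>
    P₀ x + ∑ γ, if x ∈ eΓ γ then lab (γ.1, xor γ.2 (ε γ.1.1 γ.1.2)) else 0
  have hP : ∀ x, (P x : ZMod M) ∈ ({t x, t x - σ x} : Set (ZMod M)) := by
    intro x
    have h1 := hε x
    have hne : ∀ {y z}, s(y, z) ∈ G.edgeFinset \ Finset.univ.image me → y ≠ z := fun h =>
      G.ne_of_adj (SimpleGraph.mem_edgeFinset.1 (hAE _ h).1)
    have h2 := sum_toggle w u (fun v j => hne (hwu v j).1) (fun v j => hne (hwu v j).2.1)
      (fun v j => (hwu v j).2.2) eΓ (fun v j => rfl) (fun v j => rfl) lab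
      (fun p => by simp [lab]; ring) ε x
    have h3 : (P x : ZMod M) =
        ((P₀ x + ∑ γ, if x ∈ eΓ γ then lab γ else 0 : ℤ) : ZMod M) +
          (∑ j, if ε x j then (2 : ZMod M) ^ (j : ℕ) else 0) -
          ∑ p : V × Fin q, if u p.1 p.2 = x ∧ ε p.1 p.2 then (2 : ZMod M) ^ (p.2 : ℕ) else 0 := by
      simp only [P, h2]
      push_cast
      ring
    rw [h3]
    exact h1
  obtain ⟨τ, hτ, hPτ⟩ := exists_injective_add (fun x : I => P x) Z
    fun x y h => Sum.inr_injective (Sum.inr_injective (@hl₀ (.inr (.inr x)) (.inr (.inr y)) h))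
  let Q : Fin m × Bool → ℤ := fun p => P (vx p) + ∑ x : I, if vx p ∈ e x then Z (τ x) else 0
  have hZ : ∀ x, (M : ℤ) ∣ Z x := fun x => hMBz.mul_right _
  have hcast : ∀ x y z : ℤ, (M : ℤ) ∣ y → (M : ℤ) ∣ z → ((x + y + z : ℤ) : ZMod M) = x := by
    intro x y z hy hz
    push_cast
    rw [(ZMod.intCast_zmod_eq_zero_iff_dvd y M).2 hy, (ZMod.intCast_zmod_eq_zero_iff_dvd z M).2 hz,
      add_zero, add_zero]
  have hdvdI : ∀ y, (M : ℤ) ∣ ∑ x : I, if y ∈ e x then Z (τ x) else 0 := by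
    intro y
    refine Finset.dvd_sum fun x _ => ?_
    split_ifs
    · exact hZ _
    · exact dvd_zero _
  have hQP : ∀ p, (Q p : ZMod M) = P (vx p) := by
    intro p
    have := hcast (P (vx p)) _ 0 (hdvdI (vx p)) (dvd_zero _)
    rwa [add_zero] at this
  obtain ⟨π, hπ⟩ := exists_perm_shift_ne Q M B (by exact_mod_cast hB.ne') hMBz (by
    intro x
    -- The bound (m - 1)/32 + 1 on the residue class counts x itself; removing it gives the required
    -- (m - 1)/32.
    have h1 : (Finset.univ.filter fun y => y.1 ≠ x.1 ∧ (M : ℤ) ∣ Q y - Q x) ⊆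
        (Finset.univ.filter fun p => (Q x : ZMod M) = t (vx p) ∨
          (Q x : ZMod M) = t (vx p) - σ (vx p)).erase x := by
      intro y hy
      obtain ⟨-, h2, h3⟩ := Finset.mem_filter.1 hy
      refine Finset.mem_erase.2 ⟨fun h => h2 (congrArg Prod.fst h),
        Finset.mem_filter.2 ⟨Finset.mem_univ _, ?_⟩⟩
      rw [(ZMod.intCast_eq_intCast_iff_dvd_sub (Q x) (Q y) M).2 h3, hQP]
      exact hP (vx y)
    refine (Finset.card_le_card h1).trans ?_
    rw [Finset.card_erase_of_mem (Finset.mem_filter.2 ⟨Finset.mem_univ _, by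
      rw [hQP]
      exact hP (vx x)⟩)]
    have := ht4 (Q x : ZMod M)
    omega)
  -- Labels move only within the three groups: swaps on control paths, π on matching edges, τ on
  -- private edges.
  let ψ : (V × Fin q) × Bool ⊕ (Fin m ⊕ I) → (V × Fin q) × Bool ⊕ (Fin m ⊕ I) :=
    Sum.map (fun γ => (γ.1, xor γ.2 (ε γ.1.1 γ.1.2))) (Sum.map π τ)
  have hψ : Function.Injective ψ := by
    refine Function.Injective.sumMap ?_ (π.injective.sumMap hτ)
    rintro ⟨p, b⟩ ⟨p', b'⟩ h
    obtain ⟨h1, h2⟩ := Prod.ext_iff.1 h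
    simp only at h1 h2
    subst h1
    have hxor : ∀ c d d' : Bool, xor d c = xor d' c → d = d' := by decide
    exact Prod.ext rfl (hxor _ b b' h2)
  have hbij := hf₀ (l₀ ∘ ψ) (hl₀.comp hψ) fun s =>
    Finset.mem_image_of_mem _ (Finset.mem_univ (ψ s))
  set f := Function.extend ed (l₀ ∘ ψ) f₀
  have hsum : ∀ x, vertexSum G f g x = P x +
      (∑ i, if x ∈ me i then (B : ℤ) * (((π i : ℕ) : ℤ) + 1) else 0) +
      ∑ y : I, if x ∈ e y then Z (τ y) else 0 := by
    intro x
    rw [vertexSum_extend G ed hed hedE, Fintype.sum_sum_type, Fintype.sum_sum_type]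
    exact (add_assoc _ _ _).symm.trans (add_assoc _ _ _).symm
  have hsumI : ∀ x : I, vertexSum G f g x = P x + Z (τ x) := by
    intro x
    rw [hsum, Finset.sum_eq_zero, add_zero, Finset.sum_eq_single x, if_pos (he x).2]
    · intro y _ hyx
      -- A private edge of y through x would join two unmatched vertices, against maximality.
      refine if_neg fun h => hmax x y x.2 y.2 ?_
      have h1 := (hAE _ (he y).1).1
      rw [((Sym2.mem_and_mem_iff fun h => hyx (Subtype.ext h.symm)).1 ⟨h, (he y).2⟩)] at h1
      exact SimpleGraph.mem_edgeFinset.1 h1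
    · exact fun h => absurd (Finset.mem_univ x) h
    · intro i _
      refine if_neg fun h => x.2 ?_
      obtain ⟨b, hb⟩ := (hme i x).1 h
      exact ⟨_, hb.symm⟩
  have hsumU : ∀ p, vertexSum G f g (vx p) = Q p + B * (((π p.1 : ℕ) : ℤ) + 1) := by
    intro p
    rw [hsum, Finset.sum_eq_single p.1, if_pos ((hme' _ _).2 rfl)]
    · simp only [Q]
      ring
    · exact fun i _ hi => if_neg fun h => hi ((hme' _ _).1 h).symm
    · exact fun h => absurd (Finset.mem_univ p.1) h
  have hres : ∀ x, (vertexSum G f g x : ZMod M) ∈ ({t x, t x - σ x} : Set (ZMod M)) := by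
    intro x
    rw [hsum, hcast _ _ _ _ (hdvdI x)]
    · exact hP x
    · refine Finset.dvd_sum fun i _ => ?_
      split_ifs
      · exact hMBz.mul_right _
      · exact dvd_zero _
  refine ⟨f, by simpa using hbij, ?_, ?_⟩
  · intro x y hxy h
    have hx := hres x
    have hy := hres y
    rw [h] at hx
    by_cases h1 : x ∈ Set.range vx <;> by_cases h2 : y ∈ Set.range vx
    · obtain ⟨⟨i, b⟩, rfl⟩ := h1
      obtain ⟨⟨i', b'⟩, rfl⟩ := h2
      by_cases hii : i = i'
      · subst hii
        have h3 := Set.disjoint_left.1 (ht3 i)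
        cases b <;> cases b'
        · exact hxy rfl
        · exact h3 hx hy
        · exact h3 hy hx
        · exact hxy rfl
      · rw [hsumU, hsumU] at h
        exact hπ _ _ hii h
    · obtain ⟨p, rfl⟩ := h1
      exact Set.disjoint_left.1 (ht2 y p h2) hy hx
    · obtain ⟨p, rfl⟩ := h2
      exact Set.disjoint_left.1 (ht2 x p h1) hx hy
    · rw [hsumI ⟨x, h1⟩, hsumI ⟨y, h2⟩] at h
      exact hxy (congrArg Subtype.val (hPτ h))
  · intro v
    have := ht1 v _ (hres v)
    push_cast at this
    exact this

theorem mainTheorem2 :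
    (∀ k₁ k₂ : ℕ, Odd k₁ → Odd k₂ → Nat.Coprime k₁ k₂ → 9 ≤ k₁ → 9 ≤ k₂ →
      ∃ c δ : ℕ, ConstantsWork.{u} k₁ k₂ c δ) ∧
    ConstantsWork.{u} 13 11 297 1663 := by
  constructor
  · intro k₁ k₂ _ _ _ h₁ h₂
    have hK : 81 ≤ k₁ * k₂ := Nat.mul_le_mul h₁ h₂
    set K := k₁ * k₂ with hKdef
    have hpow : ∀ n, 8 * (n + 81) ≤ 2 ^ (n + 79) := by
      intro n
      induction n with
      | zero => norm_num
      | succ n ih => rw [show n + 1 + 79 = n + 79 + 1 by ring, pow_succ]; omega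
    have hpow' := hpow (K - 81)
    rw [show K - 81 + 81 = K by omega, show K - 81 + 79 = K - 2 by omega] at hpow'
    have hlt : ∀ j : Fin (K - 2), 4 ^ ((j : ℕ) + 1) ≤ 4 ^ (K - 2) := fun j =>
      Nat.pow_le_pow_right (by norm_num) j.2
    -- M = 8K makes room for the targets: 2(129 + 8 + (K - 1)) < 8K. The offsets 2·4^j and 2·4^j +
    -- 2^j are distinct because 4^j outgrows 2^j.
    refine ⟨8 * K * 4 ^ (K - 2), _, constantsWork_of_parameters (M := 8 * K) (q := K - 2)
      (B := 8 * K * 4 ^ (K - 2)) (Dvd.intro_left 8 rfl) (by omega) (dvd_mul_right _ _)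
      (by positivity) le_rfl hpow' (by omega) (by omega) ?_ le_rfl (fun j => 2 * 4 ^ (j : ℕ)) ?_
      (fun j => by positivity) ?_⟩
    · rw [← hKdef, Nat.mul_div_cancel _ (by omega)]
      omega
    · have hb : ∀ j j' : ℕ, j < j' → 2 * 4 ^ j + 2 ^ j < 2 * 4 ^ j' := by
        intro j j' h
        have h1 : 4 ^ (j + 1) ≤ 4 ^ j' := Nat.pow_le_pow_right (by norm_num) h
        have h2 : 2 ^ j ≤ 4 ^ j := Nat.pow_le_pow_left (by norm_num) j
        have h3 := Nat.two_pow_pos j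
        rw [pow_succ] at h1
        omega
      rintro ⟨j, b⟩ ⟨j', b'⟩ h
      simp only at h
      have h1 := Nat.two_pow_pos (j : ℕ)
      have h2 := Nat.two_pow_pos (j' : ℕ)
      rcases lt_trichotomy (j : ℕ) j' with hj | hj | hj
      · have := hb _ _ hj
        split_ifs at h <;> omega
      · obtain rfl := Fin.ext hj
        cases b <;> cases b' <;> simp at h ⊢
      · have := hb _ _ hj
        split_ifs at h <;> omega
    · intro j
      have h1 := hlt j
      have h2 : 2 ^ (j : ℕ) ≤ 4 ^ (j : ℕ) := Nat.pow_le_pow_left (by norm_num) _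
      have h3 : 648 * 4 ^ (K - 2) ≤ 8 * K * 4 ^ (K - 2) := Nat.mul_le_mul_right _ (by omega)
      rw [pow_succ] at h1
      have h4 : 0 < 4 ^ (j : ℕ) := by positivity
      omega
  -- Here M = B = 2·143 ≤ 2⁹ and 2(129 + 2 + 10) = 282 < 286. The listed offsets and their sums with
  -- 1, 2, 4, …, 256 are 18 distinct numbers, the largest being 257.
  · exact constantsWork_of_parameters (M := 286) (q := 9) (B := 286) (by norm_num) (by norm_num)
      (by norm_num) (by norm_num) (by norm_num) (by norm_num) (by norm_num) (by norm_num)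
      (by norm_num) (by norm_num) ![12, 8, 7, 6, 5, 4, 3, 2, 1] (by decide) (by decide) (by decide)
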